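/- Let $p$ be an odd prime and let $G$ be a $p$-group, i.e. a group (not necessarily finite) in which every element has order a power of $p$. Suppose that $G$ is nilpotent of class at most $5$. Let $G\wedge G$ be the nonabelian exterior square of $G$: the group generated by the symbols $g\wedge h$ $(g,h\in G)$ subject to the relations $$gg'\wedge h=(g^{g'}\wedge h^{g'})(g'\wedge h),\qquad g\wedge hh'=(g\wedge h')(g^{h'}\wedge h^{h'}),\qquad g\wedge g=1$$ for all $g,g',h,h'\in G$, where $x^y=y^{-1}xy$. Then $\exp(G\wedge G)$ divides $\exp(G)$. Here $\exp$ denotes the exponent of a group, with the convention that it is $0$ for a group of unbounded exponent; so the claim is that if $x^n=1$ for all $x\in G$, where $n\ge 1$, then $t^n=1$ for all $t\in G\wedge G$. -/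

import Mathlib

/-- The defining relators of the nonabelian exterior square `G ∧ G`, in the free group on symbols
`(g, h)` (standing for `g ∧ h`). Conjugation acts on the right, `x ^ y = y⁻¹ * x * y`. -/
inductive ExteriorSquareRel (G : Type*) [Group G] : FreeGroup (G × G) → Prop
  /-- `g g' ∧ h = (g ^ g' ∧ h ^ g') (g' ∧ h)` -/
  | mul_left (g g' h : G) : ExteriorSquareRel G
      (FreeGroup.of (g * g', h) *
        (FreeGroup.of (g'⁻¹ * g * g', g'⁻¹ * h * g') * FreeGroup.of (g', h))⁻¹)
  /-- `g ∧ h h' = (g ∧ h') (g ^ h' ∧ h ^ h')` -/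
  | mul_right (g h h' : G) : ExteriorSquareRel G
      (FreeGroup.of (g, h * h') *
        (FreeGroup.of (g, h') * FreeGroup.of (h'⁻¹ * g * h', h'⁻¹ * h * h'))⁻¹)
  /-- `g ∧ g = 1` -/
  | self (g : G) : ExteriorSquareRel G (FreeGroup.of (g, g))

/-- The nonabelian exterior square `G ∧ G` of a group `G` (Brown and Loday): the nonabelian tensor
square `G ⊗ G` modulo the elements `g ⊗ g`, given by generators and relations. -/
abbrev ExteriorSquare (G : Type*) [Group G] : Type _ :=
  PresentedGroup {r : FreeGroup (G × G) | ExteriorSquareRel G r}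

/-! Let n > 0 be the exponent of G, M = G ∧ G, S = M ⋊ G (`Extension`), and M_k = [M, S, …, S] with
k copies of S (`relSeries`). The commutator map M → G is a crossed module with kernel central in S.
Hence n-th powers in S are central, and class at most 5 gives M_5 = 1. As g ∧ h acts on M like [g,
h], one gets [M_i, M_j] ≤ M_{i+j+2} (`commutator_relSeries_le`).

So (xc)^n with c in M expands into few iterated commutators with binomial exponents
(`mul_pow_eq_of_relSeries`). Centrality of n-th powers forces M_1 to have exponent dividing n; as n
is odd, only the exponents C(n,3) and C(n,5) matter (`mul_pow_eq_of_central`). Since (x(x ∧ y))^n =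
x^n (x^n ∧ y) = 1, the power (x ∧ y)^n is the inverse of an explicit error term
(`β_pow_mul_eq_one`).

As n is a power of p, it is prime to 3 or to 5. If 3 ∤ n, the error is the quartic form [x ∧ y, x,
x, x, x]^C(n,5). Exchanging x and y shows that it equals the same form at y. Since xy^k ∧ y ≡ x ∧ y
modulo M_1, its values at all xy^k agree, and a fourth difference yields 24 times the value at y, so
that value is trivial.

If 5 ∤ n, the same argument with second differences kills [x ∧ y, x, x]^C(n,3), once M_3 is known to
be killed by C(n,3) (`relSeries_three_pow_eq_one`). For this, the power expansion gives [y, x, x,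
z]^C(n,3) = 1. In a suitable quotient [y, a, b] is then alternating in a, b, and a Jacobi identity
plus antisymmetry under exchange of pairs make it vanish (`relSeries_two_eq_bot`). -/

/-! ### Commutator calculus for [a, b] = a⁻¹b⁻¹ab. -/

section RightCommutator

open scoped commutatorElement

variable {S : Type*} [Group S]

/-- The right commutator `a⁻¹ b⁻¹ a b`. -/
def rcomm (a b : S) : S := a⁻¹ * b⁻¹ * a * b

theorem rcomm_eq_commutatorElement (a b : S) : rcomm a b = ⁅a⁻¹, b⁻¹⁆ := by
  simp [rcomm, commutatorElement_def]

theorem mul_eq_mul_rcomm (a b : S) : a * b = b * (a * rcomm a b) := by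
  simp only [rcomm]; group

theorem conj_eq_mul_rcomm (a b : S) : b⁻¹ * a * b = a * rcomm a b := by
  simp only [rcomm]; group

theorem rcomm_eq_one_iff {a b : S} : rcomm a b = 1 ↔ Commute a b := by
  rw [rcomm_eq_commutatorElement, commutatorElement_eq_one_iff_commute, Commute.inv_left_iff,
    Commute.inv_right_iff]

theorem rcomm_mul_left (a b c : S) :
    rcomm (a * b) c = rcomm a c * rcomm (rcomm a c) b * rcomm b c := by
  simp only [rcomm]; group

theorem rcomm_mul_right (a b c : S) :
    rcomm a (b * c) = rcomm a c * rcomm a b * rcomm (rcomm a b) c := by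
  simp only [rcomm]; group

@[simp] theorem rcomm_one_left (a : S) : rcomm 1 a = 1 := by simp [rcomm]

theorem rcomm_inv (a b : S) : (rcomm a b)⁻¹ = rcomm b a := by
  simp only [rcomm]; group

theorem map_rcomm {Q F : Type*} [Group Q] [FunLike F S Q] [MonoidHomClass F S Q] (f : F) (a b : S) :
    f (rcomm a b) = rcomm (f a) (f b) := by
  simp [rcomm]

theorem Subgroup.commutator_commutator_le_of_rotate {A B C N : Subgroup S} [N.Normal]
    (h₁ : ⁅⁅B, C⁆, A⁆ ≤ N) (h₂ : ⁅⁅C, A⁆, B⁆ ≤ N) : ⁅⁅A, B⁆, C⁆ ≤ N := by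
  have key : ∀ X : Subgroup S, X.map (QuotientGroup.mk' N) = ⊥ ↔ X ≤ N := fun X => by
    rw [Subgroup.map_eq_bot_iff, QuotientGroup.ker_mk']
  rw [← key, Subgroup.map_commutator, Subgroup.map_commutator] at *
  exact Subgroup.commutator_commutator_eq_bot_of_rotate h₁ h₂

end RightCommutator

/-! ### The relative lower central series of M in S. -/

section RelSeries

open scoped commutatorElement

variable {S : Type*} [Group S]

/-- The lower central series of `S` relative to a subgroup `M`: `M, [M, S], [M, S, S], …`. -/
def relSeries (M : Subgroup S) : ℕ → Subgroup S
  | 0 => M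
  | k + 1 => ⁅relSeries M k, ⊤⁆

variable {M : Subgroup S}

instance relSeries_normal [hM : M.Normal] : ∀ k, (relSeries M k).Normal
  | 0 => hM
  | k + 1 => by
    have := relSeries_normal (hM := hM) k
    exact Subgroup.commutator_normal _ _

theorem relSeries_succ_le [M.Normal] (k : ℕ) : relSeries M (k + 1) ≤ relSeries M k :=
  Subgroup.commutator_le_left _ _

theorem relSeries_antitone [M.Normal] : Antitone (relSeries M) :=
  antitone_nat_of_succ_le relSeries_succ_le

theorem rcomm_mem_relSeries [M.Normal] {k : ℕ} {a : S} (ha : a ∈ relSeries M k) (x : S) :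
    rcomm a x ∈ relSeries M (k + 1) := by
  rw [rcomm_eq_commutatorElement]
  exact Subgroup.commutator_mem_commutator (inv_mem ha) (Subgroup.mem_top _)

theorem relSeries_succ_le_iff [M.Normal] {k : ℕ} {N : Subgroup S} :
    relSeries M (k + 1) ≤ N ↔ ∀ a ∈ relSeries M k, ∀ x, rcomm a x ∈ N := by
  constructor
  · exact fun h a ha x => h (rcomm_mem_relSeries ha x)
  · intro h
    refine Subgroup.commutator_le.2 fun a ha x _ => ?_
    have := h a⁻¹ (inv_mem ha) x⁻¹
    rwa [rcomm_eq_commutatorElement, inv_inv, inv_inv] at this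

theorem map_relSeries {Q : Type*} [Group Q] {f : S →* Q} (hf : Function.Surjective f) (k : ℕ) :
    (relSeries M k).map f = relSeries (M.map f) k := by
  induction k with
  | zero => rfl
  | succ k ih =>
    rw [relSeries, relSeries, Subgroup.map_commutator, ih, Subgroup.map_top_of_surjective f hf]

theorem commutator_relSeries_lowerCentralSeries_le [M.Normal] (i k : ℕ) :
    ⁅relSeries M i, (⊤ : Subgroup S).lowerCentralSeries k⁆ ≤ relSeries M (i + k + 1) := by
  induction k generalizing i with
  | zero => exact le_rfl
  | succ k ih =>
    rw [Subgroup.lowerCentralSeries_succ, Subgroup.commutator_comm]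
    -- Three subgroups lemma.
    refine Subgroup.commutator_commutator_le_of_rotate ?_ ?_
    · rw [Subgroup.commutator_comm ⊤]
      exact (ih (i + 1)).trans (le_of_eq (by congr 1; omega))
    · exact (Subgroup.commutator_mono (ih i) le_rfl).trans (le_of_eq (by rw [← relSeries]; congr 1))

theorem relSeries_le_lowerCentralSeries_sup [M.Normal]
    (hM : M ≤ ⁅(⊤ : Subgroup S), ⊤⁆ ⊔ Subgroup.centralizer (M : Set S)) (k : ℕ) :
    relSeries M k ≤
      (⊤ : Subgroup S).lowerCentralSeries (k + 1) ⊔ Subgroup.centralizer (M : Set S) := by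
  induction k with
  | zero => exact hM
  | succ k ih =>
    refine Subgroup.commutator_le.2 fun a ha x _ => ?_
    obtain ⟨g, hg, c, hc, rfl⟩ := Subgroup.mem_sup_of_normal_right.1 (ih ha)
    rw [commutatorElement_mul_left_eq_conj_mul]
    refine mul_mem (Subgroup.mem_sup_right ?_) (Subgroup.mem_sup_left ?_)
    · exact (inferInstance : (Subgroup.centralizer (M : Set S)).Normal).conj_mem _
        (Subgroup.commutator_le_left _ ⊤ (Subgroup.commutator_mem_commutator hc (Subgroup.mem_top _))) g
    · exact Subgroup.commutator_mem_commutator hg (Subgroup.mem_top _)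

/-- An element of M_j is gc with g in γ_{j+2}(S) and c centralizing M, so only g contributes to a
commutator with M_i. This gains one step over the filtration expected for a general normal subgroup.
-/
theorem commutator_relSeries_le [M.Normal]
    (hM : M ≤ ⁅(⊤ : Subgroup S), ⊤⁆ ⊔ Subgroup.centralizer (M : Set S)) (i j : ℕ) :
    ⁅relSeries M i, relSeries M j⁆ ≤ relSeries M (i + j + 2) := by
  refine Subgroup.commutator_le.2 fun a ha b hb => ?_
  obtain ⟨g, hg, c, hc, rfl⟩ :=
    Subgroup.mem_sup_of_normal_right.1 (relSeries_le_lowerCentralSeries_sup hM j hb)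
  have hac : Commute c a :=
    (Subgroup.mem_centralizer_iff.1 hc a (relSeries_antitone (Nat.zero_le i) ha)).symm
  have : ⁅a, g * c⁆ = ⁅a, g⁆ := by
    simp only [commutatorElement_def, mul_inv_rev]
    calc a * (g * c) * a⁻¹ * (c⁻¹ * g⁻¹) = a * g * (c * a⁻¹) * c⁻¹ * g⁻¹ := by group
      _ = a * g * a⁻¹ * g⁻¹ := by rw [hac.inv_right.eq]; group
  rw [this]
  exact commutator_relSeries_lowerCentralSeries_le i (j + 1)
    (Subgroup.commutator_mem_commutator ha hg)

end RelSeries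

/-! ### Expansion of (xc)^k. -/

section PowerFormula

variable {S : Type*} [Group S]

theorem comm_group_aux_succ {A : Type*} [CommGroup A] (a b c d : A) (k : ℕ) :
    a ^ (k + 1) * b ^ (k + 1).choose 2 * c ^ (k + 1).choose 3 * d ^ (k + 1).choose 4 =
      a * ((a * b) ^ k * (b * c) ^ k.choose 2 * (c * d) ^ k.choose 3 * d ^ k.choose 4) := by
  simp only [Nat.choose_succ_succ' k, Nat.choose_one_right, Nat.reduceAdd, mul_pow, pow_add,
    pow_one]
  ac_rfl

theorem comm_group_aux_mul {A : Type*} [CommGroup A] (a b c d e f : A) (k l : ℕ) :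
    a ^ k * b ^ l * c * d * (e ^ k * f ^ l) = (a * e) ^ k * (b * f) ^ l * c * d := by
  simp only [mul_pow]
  ac_rfl

theorem comm_group_aux_pow {A : Type*} [CommGroup A] (a b c d e f : A) (k r s : ℕ) :
    a ^ k * b ^ k.choose 2 * c ^ k.choose 3 * d ^ k.choose 4 * (e ^ k * f ^ k.choose 2) ^ k *
        (a ^ k.choose 2 * b ^ k.choose 3 * c ^ k.choose 4 * d ^ k.choose 5 * e ^ r * f ^ s) =
      a ^ (k + 1).choose 2 * b ^ (k + 1).choose 3 * c ^ (k + 1).choose 4 * d ^ (k + 1).choose 5 *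
        e ^ (k * k + r) * f ^ (k.choose 2 * k + s) := by
  simp only [Nat.choose_succ_succ' k, Nat.choose_one_right, Nat.reduceAdd, mul_pow, ← pow_mul,
    pow_add]
  ac_rfl

/-- Expansion of `(x * c) ^ k` when the commutators of `c` with `x` form a chain of length at most
four generating an abelian group on which `c` acts quadratically. -/
theorem mul_pow_eq_of_semiconj {B : Subgroup S} (hB : ∀ a ∈ B, ∀ b ∈ B, a * b = b * a)
    {x c d₁ d₂ d₃ d₄ e f : S} (hd₁ : ∀ b ∈ B, d₁ * b = b * d₁)
    (hd₂ : d₂ ∈ B) (hd₃ : d₃ ∈ B) (hd₄ : d₄ ∈ B) (he : e ∈ B) (hf : f ∈ B)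
    (h₀ : SemiconjBy x (c * d₁) c) (h₁ : SemiconjBy x (d₁ * d₂) d₁)
    (h₂ : SemiconjBy x (d₂ * d₃) d₂) (h₃ : SemiconjBy x (d₃ * d₄) d₃) (h₄ : Commute x d₄)
    (g₁ : SemiconjBy c (d₁ * e) d₁) (g₂ : SemiconjBy c (d₂ * f) d₂) (g₃ : Commute c d₃)
    (g₄ : Commute c d₄) (ge : Commute c e) (gf : Commute c f) (k : ℕ) :
    (x * c) ^ k = x ^ k * (c ^ k * (d₁ ^ k.choose 2 * d₂ ^ k.choose 3 * d₃ ^ k.choose 4 *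
      d₄ ^ k.choose 5 * e ^ (2 * k.choose 3 + k.choose 2) *
      f ^ (3 * k.choose 4 + 2 * k.choose 3))) := by
  let D : Subgroup S := Subgroup.closure (insert d₁ (B : Set S))
  have hD : ∀ a ∈ D, ∀ b ∈ D, a * b = b * a := by
    have : ∀ a ∈ insert d₁ (B : Set S), ∀ b ∈ insert d₁ (B : Set S), a * b = b * a := by
      rintro a (rfl | ha) b (rfl | hb)
      · rfl
      · exact hd₁ b hb
      · exact (hd₁ a ha).symm
      · exact hB a ha b hb
    have := Subgroup.isMulCommutative_closure this
    exact fun a ha b hb => setLike_mul_comm ha hb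
  have hd₁D : d₁ ∈ D := Subgroup.subset_closure (Or.inl rfl)
  have hBD : ∀ b ∈ B, b ∈ D := fun b hb => Subgroup.subset_closure (Or.inr hb)
  clear_value D
  let _ : CommGroup D := { mul_comm := fun a b => Subtype.ext (hD a a.2 b b.2) }
  obtain ⟨D₁, rfl⟩ : ∃ y : D, (y : S) = d₁ := ⟨⟨d₁, hd₁D⟩, rfl⟩
  obtain ⟨D₂, rfl⟩ : ∃ y : D, (y : S) = d₂ := ⟨⟨d₂, hBD _ hd₂⟩, rfl⟩
  obtain ⟨D₃, rfl⟩ : ∃ y : D, (y : S) = d₃ := ⟨⟨d₃, hBD _ hd₃⟩, rfl⟩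
  obtain ⟨D₄, rfl⟩ : ∃ y : D, (y : S) = d₄ := ⟨⟨d₄, hBD _ hd₄⟩, rfl⟩
  obtain ⟨E, rfl⟩ : ∃ y : D, (y : S) = e := ⟨⟨e, hBD _ he⟩, rfl⟩
  obtain ⟨F, rfl⟩ : ∃ y : D, (y : S) = f := ⟨⟨f, hBD _ hf⟩, rfl⟩
  -- Conjugation by x^k sends c to c · V k, with binomial exponents by Pascal's rule.
  let V : ℕ → D := fun k => D₁ ^ k * D₂ ^ k.choose 2 * D₃ ^ k.choose 3 * D₄ ^ k.choose 4
  have hx : ∀ k, SemiconjBy (x ^ k) (c * V k) c := by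
    intro k
    induction k with
    | zero => simp [V]
    | succ k ih =>
      have h : SemiconjBy x (((D₁ * D₂) ^ k * (D₂ * D₃) ^ k.choose 2 * (D₃ * D₄) ^ k.choose 3 *
          D₄ ^ k.choose 4 : D) : S) (V k) := by
        push_cast
        exact (((h₁.pow_right _).mul_right (h₂.pow_right _)).mul_right
          (h₃.pow_right _)).mul_right (h₄.pow_right _)
      have hV : V (k + 1) = D₁ * ((D₁ * D₂) ^ k * (D₂ * D₃) ^ k.choose 2 *
          (D₃ * D₄) ^ k.choose 3 * D₄ ^ k.choose 4) := by
        exact comm_group_aux_succ D₁ D₂ D₃ D₄ k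
      have h' := h₀.mul_right h
      rw [mul_assoc, ← Subgroup.coe_mul, ← hV] at h'
      rw [pow_succ]
      exact ih.mul_left h'
  have hc : ∀ k j, SemiconjBy (c ^ j) (V k * (E ^ k * F ^ k.choose 2) ^ j : D) (V k : S) := by
    intro k j
    have hEF : Commute c ((E ^ k * F ^ k.choose 2 : D) : S) := by
      push_cast; exact (ge.pow_right _).mul_right (gf.pow_right _)
    have h : SemiconjBy c (V k * (E ^ k * F ^ k.choose 2) : D) (V k : S) := by
      have : V k * (E ^ k * F ^ k.choose 2) = (D₁ * E) ^ k * (D₂ * F) ^ k.choose 2 *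
          D₃ ^ k.choose 3 * D₄ ^ k.choose 4 := by
        exact comm_group_aux_mul D₁ D₂ (D₃ ^ k.choose 3) (D₄ ^ k.choose 4) E F k (k.choose 2)
      rw [this]; push_cast
      exact (((g₁.pow_right _).mul_right (g₂.pow_right _)).mul_right
        (g₃.pow_right _)).mul_right (g₄.pow_right _)
    induction j with
    | zero => simp
    | succ j ih =>
      have h' := h.mul_right (hEF.pow_right j)
      rw [← Subgroup.coe_pow, ← Subgroup.coe_mul, mul_assoc (V k), ← pow_succ'] at h'
      rw [pow_succ c]
      exact ih.mul_left h'
  have hk : ∀ k : ℕ, (x * c) ^ k = x ^ k * (c ^ k * (D₁ ^ k.choose 2 * D₂ ^ k.choose 3 *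
      D₃ ^ k.choose 4 * D₄ ^ k.choose 5 * E ^ (2 * k.choose 3 + k.choose 2) *
      F ^ (3 * k.choose 4 + 2 * k.choose 3) : D)) := by
    intro k
    induction k with
    | zero => simp
    | succ k ih =>
      have hW : ∀ W : D, x * c * (x ^ k * (c ^ k * W)) =
          x ^ (k + 1) * (c ^ (k + 1) * (V k * (E ^ k * F ^ k.choose 2) ^ k * W : D)) := by
        intro W
        calc x * c * (x ^ k * (c ^ k * W)) = x * (c * x ^ k) * (c ^ k * W) := by group
          _ = x * x ^ k * c * (V k * c ^ k) * W := by rw [← (hx k).eq]; group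
          _ = _ := by rw [← (hc k k).eq, pow_succ' x, pow_succ' c]; push_cast; group
      rw [pow_succ', ih, hW]
      congr 3
      -- The next identities rewrite the exponents of E and F, produced by moving c^k past V k, in
      -- the binomial basis.
      have h1 : k * k = 2 * k.choose 2 + k := by
        rcases k with _ | k
        · rfl
        · have h := Nat.add_one_mul_choose_eq k 1
          simp only [Nat.choose_one_right] at h
          nlinarith
      have h2 : k * k.choose 2 = 3 * k.choose 3 + 2 * k.choose 2 := by
        rcases k with _ | _ | k
        · rfl
        · rfl
        · have h := Nat.choose_succ_right_eq (k + 2) 2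
          simp only [Nat.add_sub_cancel] at h
          nlinarith
      have h3 : 2 * (k + 1).choose 3 + (k + 1).choose 2 =
          k * k + (2 * k.choose 3 + k.choose 2) := by
        simp only [Nat.choose_succ_succ' k, Nat.choose_one_right, Nat.reduceAdd]; omega
      have h4 : 3 * (k + 1).choose 4 + 2 * (k + 1).choose 3 =
          k.choose 2 * k + (3 * k.choose 4 + 2 * k.choose 3) := by
        rw [mul_comm _ k]
        simp only [Nat.choose_succ_succ' k, Nat.reduceAdd]; omega
      rw [h3, h4]
      exact comm_group_aux_pow D₁ D₂ D₃ D₄ E F k _ _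
  simpa using hk k

end PowerFormula

/-! ### Multilinearity of iterated commutators at the bottom of the series. -/

section IteratedCommutator

open scoped commutatorElement

variable {S : Type*} [Group S]

/-- The left-normed iterated commutator `[a, x₁, …, xₙ]`. -/
def icomm (a : S) (xs : List S) : S := xs.foldl rcomm a

@[simp] theorem icomm_nil (a : S) : icomm a [] = a := rfl

@[simp] theorem icomm_cons (a x : S) (xs : List S) : icomm a (x :: xs) = icomm (rcomm a x) xs := rfl

theorem icomm_append (a : S) (xs ys : List S) : icomm a (xs ++ ys) = icomm (icomm a xs) ys :=
  List.foldl_append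

@[simp] theorem icomm_one (xs : List S) : icomm 1 xs = 1 := by
  induction xs with
  | nil => rfl
  | cons x xs ih => simpa using ih

variable {M : Subgroup S} [M.Normal]

theorem icomm_mem_relSeries {k : ℕ} {a : S} (ha : a ∈ relSeries M k) (xs : List S) :
    icomm a xs ∈ relSeries M (k + xs.length) := by
  induction xs generalizing k a with
  | nil => exact ha
  | cons x xs ih =>
    have := ih (rcomm_mem_relSeries ha x)
    rwa [Nat.add_right_comm] at this

theorem eq_one_of_mem_relSeries {k m : ℕ} (hm : relSeries M m = ⊥) (hk : m ≤ k) {a : S}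
    (ha : a ∈ relSeries M k) : a = 1 := by
  have := relSeries_antitone hk ha
  rwa [hm, Subgroup.mem_bot] at this

theorem mem_center_of_mem_relSeries {k m : ℕ} (hm : relSeries M m = ⊥) (hk : m ≤ k + 1) {a : S}
    (ha : a ∈ relSeries M k) : a ∈ Subgroup.center S :=
  Subgroup.mem_center_iff.2 fun x =>
    (rcomm_eq_one_iff.1 (eq_one_of_mem_relSeries hm hk (rcomm_mem_relSeries ha x))).symm

theorem icomm_eq_one {k m : ℕ} (hm : relSeries M m = ⊥) {a : S} (ha : a ∈ relSeries M k)
    (xs : List S) (hk : m ≤ k + xs.length) : icomm a xs = 1 :=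
  eq_one_of_mem_relSeries hm hk (icomm_mem_relSeries ha xs)

/-- The bound on m says that the commutator lands in the last possibly nontrivial term, so every
correction falls into M_m = 1. -/
theorem icomm_mul {k m : ℕ} (hm : relSeries M m = ⊥) {a b : S} (ha : a ∈ relSeries M k)
    (hb : b ∈ relSeries M k) (xs : List S) (hk : m ≤ k + xs.length + 1) :
    icomm (a * b) xs = icomm a xs * icomm b xs := by
  induction xs generalizing k a b with
  | nil => rfl
  | cons x xs ih =>
    have hk' : m ≤ k + 1 + xs.length + 1 := by
      rw [List.length_cons] at hk; omega
    have hax := rcomm_mem_relSeries ha x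
    have hbx := rcomm_mem_relSeries hb x
    have hab := rcomm_mem_relSeries hax b
    have hab' := relSeries_succ_le _ hab
    rw [icomm_cons, rcomm_mul_left, ih (mul_mem hax hab') hbx hk', ih hax hab' hk',
      icomm_eq_one hm hab xs (by omega), mul_one]
    rfl

theorem icomm_inv {k m : ℕ} (hm : relSeries M m = ⊥) {a : S} (ha : a ∈ relSeries M k)
    (xs : List S) (hk : m ≤ k + xs.length + 1) : icomm a⁻¹ xs = (icomm a xs)⁻¹ := by
  rw [eq_inv_iff_mul_eq_one, ← icomm_mul hm (inv_mem ha) ha xs hk, inv_mul_cancel, icomm_one]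

theorem icomm_mul_cons {k m : ℕ} (hm : relSeries M m = ⊥) {a : S} (ha : a ∈ relSeries M k)
    (x y : S) (xs : List S) (hk : m ≤ k + xs.length + 2) :
    icomm a ((x * y) :: xs) = icomm a (x :: xs) * icomm a (y :: xs) := by
  have hk' : m ≤ k + 1 + xs.length + 1 := by omega
  have hax := rcomm_mem_relSeries ha x
  have hay := rcomm_mem_relSeries ha y
  have haxy := rcomm_mem_relSeries hax y
  have haxy' := relSeries_succ_le _ haxy
  simp only [icomm_cons]
  rw [rcomm_mul_right, icomm_mul hm (mul_mem hay hax) haxy' xs hk', icomm_mul hm hay hax xs hk',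
    icomm_eq_one hm haxy xs (by omega), mul_one]
  exact (Subgroup.mem_center_iff.1 (mem_center_of_mem_relSeries hm hk'
    (icomm_mem_relSeries hax xs)) _)

theorem icomm_mul_slot {k m : ℕ} (hm : relSeries M m = ⊥) {a : S} (ha : a ∈ relSeries M k)
    (ws : List S) (x y : S) (xs : List S) (hk : m ≤ k + ws.length + xs.length + 2) :
    icomm a (ws ++ (x * y) :: xs) = icomm a (ws ++ x :: xs) * icomm a (ws ++ y :: xs) := by
  simp only [icomm_append]
  exact icomm_mul_cons hm (icomm_mem_relSeries ha ws) x y xs hk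

section

variable (hc : ∀ i j, ⁅relSeries M i, relSeries M j⁆ ≤ relSeries M (i + j + 2))
include hc

omit [M.Normal] in
theorem rcomm_mem_relSeries_of_mem {i j : ℕ} {a b : S} (ha : a ∈ relSeries M i)
    (hb : b ∈ relSeries M j) : rcomm a b ∈ relSeries M (i + j + 2) := by
  rw [rcomm_eq_commutatorElement]
  exact hc i j (Subgroup.commutator_mem_commutator (inv_mem ha) (inv_mem hb))

theorem commute_of_mem_relSeries {m i j : ℕ} (hm : relSeries M m = ⊥) (hij : m ≤ i + j + 2)
    {a b : S} (ha : a ∈ relSeries M i) (hb : b ∈ relSeries M j) : Commute a b :=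
  rcomm_eq_one_iff.1 (eq_one_of_mem_relSeries hm hij (rcomm_mem_relSeries_of_mem hc ha hb))

/-- Expansion of `(x * c) ^ k` for `c ∈ M` when `[M, S, S, S, S, S] = 1`. -/
theorem mul_pow_eq_of_relSeries (h5 : relSeries M 5 = ⊥) (x : S) {c : S} (hcM : c ∈ M) (k : ℕ) :
    (x * c) ^ k = x ^ k * (c ^ k * (rcomm c x ^ k.choose 2 * icomm c [x, x] ^ k.choose 3 *
      icomm c [x, x, x] ^ k.choose 4 * icomm c [x, x, x, x] ^ k.choose 5 *
      rcomm (rcomm c x) c ^ (2 * k.choose 3 + k.choose 2) *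
      rcomm (icomm c [x, x]) c ^ (3 * k.choose 4 + 2 * k.choose 3))) := by
  have m0 : c ∈ relSeries M 0 := hcM
  have m1 := rcomm_mem_relSeries m0 x
  have m2 := rcomm_mem_relSeries m1 x
  have m3 := rcomm_mem_relSeries m2 x
  have m4 := rcomm_mem_relSeries m3 x
  have me := rcomm_mem_relSeries_of_mem hc m1 m0
  have mf := rcomm_mem_relSeries_of_mem hc m2 m0
  have sc : ∀ a y : S, SemiconjBy y (a * rcomm a y) a := fun a y => (mul_eq_mul_rcomm a y).symm
  have le2 : ∀ {j : ℕ} {a : S}, 2 ≤ j → a ∈ relSeries M j → a ∈ relSeries M 2 :=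
    fun h ha => relSeries_antitone h ha
  exact mul_pow_eq_of_semiconj (B := relSeries M 2)
    (fun a ha b hb => commute_of_mem_relSeries hc h5 (by omega) ha hb)
    (fun b hb => commute_of_mem_relSeries hc h5 (by omega) m1 hb)
    m2 (le2 (by omega) m3) (le2 (by omega) m4) (le2 (by omega) me) (le2 (by omega) mf)
    (sc _ _) (sc _ _) (sc _ _) (sc _ _)
    (Subgroup.mem_center_iff.1 (mem_center_of_mem_relSeries h5 (by omega) m4) x)
    (sc _ _) (sc _ _) (commute_of_mem_relSeries hc h5 (by omega) m0 m3)
    (commute_of_mem_relSeries hc h5 (by omega) m0 m4)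
    (commute_of_mem_relSeries hc h5 (by omega) m0 me)
    (commute_of_mem_relSeries hc h5 (by omega) m0 mf) k

end

end IteratedCommutator

/-! ### Consequences of n-th powers being central. -/

section CentralPowers

open scoped commutatorElement

variable {S : Type*} [Group S]

/-- The elements of an abelian subgroup killed by `m`. -/
def Subgroup.torsionOf (A : Subgroup S) (hA : ∀ a ∈ A, ∀ b ∈ A, Commute a b) (m : ℕ) :
    Subgroup S where
  carrier := {a | a ∈ A ∧ a ^ m = 1}
  one_mem' := ⟨one_mem _, one_pow _⟩
  mul_mem' := fun {a b} ha hb =>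
    ⟨mul_mem ha.1 hb.1, by rw [(hA a ha.1 b hb.1).mul_pow, ha.2, hb.2, one_mul]⟩
  inv_mem' := fun {a} ha => ⟨inv_mem ha.1, by rw [inv_pow, ha.2, inv_one]⟩

instance Subgroup.torsionOf_normal {A : Subgroup S} [A.Normal]
    {hA : ∀ a ∈ A, ∀ b ∈ A, Commute a b} {m : ℕ} : (A.torsionOf hA m).Normal where
  conj_mem := fun a ha g => ⟨(inferInstance : A.Normal).conj_mem a ha.1 g, by
    rw [conj_pow, ha.2, mul_one, mul_inv_cancel]⟩

theorem pow_eq_one_of_dvd {a : S} {n m : ℕ} (h : n ∣ m) (ha : a ^ n = 1) : a ^ m = 1 :=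
  orderOf_dvd_iff_pow_eq_one.1 ((orderOf_dvd_of_pow_eq_one ha).trans h)

/-- Here a[a, x] is the conjugate of a by x, and a^n is central. -/
theorem mul_rcomm_pow_eq {n : ℕ} (hZ : ∀ s : S, s ^ n ∈ Subgroup.center S) (a x : S) :
    (a * rcomm a x) ^ n = a ^ n := by
  rw [← conj_eq_mul_rcomm]
  have := conj_pow (i := n) (a := x⁻¹) (b := a)
  rw [inv_inv] at this
  rw [this, mul_assoc, ← Subgroup.mem_center_iff.1 (hZ a) x, inv_mul_cancel_left]

variable {M : Subgroup S} [M.Normal]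
  (hc : ∀ i j, ⁅relSeries M i, relSeries M j⁆ ≤ relSeries M (i + j + 2)) (h5 : relSeries M 5 = ⊥)
  {n : ℕ} (hZ : ∀ s : S, s ^ n ∈ Subgroup.center S)
include hc h5

theorem commute_of_mem_relSeries_two : ∀ a ∈ relSeries M 2, ∀ b ∈ relSeries M 2, Commute a b :=
  fun _ ha _ hb => commute_of_mem_relSeries hc h5 (by omega) ha hb

include hZ

/-- For a in M_1 and d = [a, x], expand (ad)^n = a^n. Every correction involves [d, a], which lies
in M_5 = 1, so d^n = 1. -/
theorem pow_eq_one_of_mem_relSeries_two : ∀ a ∈ relSeries M 2, a ^ n = 1 := by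
  suffices relSeries M 2 ≤ (relSeries M 2).torsionOf (commute_of_mem_relSeries_two hc h5) n from
    fun a ha => (this ha).2
  refine relSeries_succ_le_iff.2 fun a ha x => ?_
  have hd := rcomm_mem_relSeries ha x
  refine ⟨hd, ?_⟩
  have h := mul_pow_eq_of_relSeries hc h5 a (relSeries_antitone (Nat.zero_le _) hd) n
  have h1 : rcomm (rcomm a x) a = 1 :=
    rcomm_eq_one_iff.2 (commute_of_mem_relSeries hc h5 (by omega) hd ha)
  rw [mul_rcomm_pow_eq hZ] at h
  simpa [h1] using h

theorem pow_eq_one_of_mem_relSeries_one (h2 : n ∣ n.choose 2) :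
    ∀ a ∈ relSeries M 1, a ^ n = 1 := by
  -- M_1 need not be abelian, so closure under products is itself an instance of the power
  -- expansion.
  let N : Subgroup S :=
    { carrier := {a | a ∈ relSeries M 1 ∧ a ^ n = 1}
      one_mem' := ⟨one_mem _, one_pow _⟩
      inv_mem' := fun {a} ha => ⟨inv_mem ha.1, by rw [inv_pow, ha.2, inv_one]⟩
      mul_mem' := fun {a b} ha hb => by
        refine ⟨mul_mem ha.1 hb.1, ?_⟩
        have h := mul_pow_eq_of_relSeries hc h5 a (relSeries_antitone (Nat.zero_le _) hb.1) n
        have hd := rcomm_mem_relSeries_of_mem hc hb.1 ha.1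
        have h1 : ∀ y, rcomm (rcomm b a) y = 1 := fun y =>
          eq_one_of_mem_relSeries h5 (by omega) (rcomm_mem_relSeries hd y)
        have h3 := pow_eq_one_of_dvd h2 (pow_eq_one_of_mem_relSeries_two hc h5 hZ _
          (relSeries_antitone (by omega) hd))
        simpa [h1, h3, ha.2, hb.2] using h }
  suffices relSeries M 1 ≤ N from fun a ha => (this ha).2
  refine relSeries_succ_le_iff.2 fun a ha x => ?_
  have hd := rcomm_mem_relSeries ha x
  refine ⟨hd, ?_⟩
  have h := mul_pow_eq_of_relSeries hc h5 a (relSeries_antitone (Nat.zero_le _) hd) n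
  have hda := rcomm_mem_relSeries_of_mem hc hd ha
  have h1 : rcomm (rcomm (rcomm a x) a) a = 1 :=
    eq_one_of_mem_relSeries h5 (by omega) (rcomm_mem_relSeries_of_mem hc hda ha)
  have h1' : rcomm (rcomm (rcomm a x) a) (rcomm a x) = 1 :=
    eq_one_of_mem_relSeries h5 (by omega) (rcomm_mem_relSeries_of_mem hc hda hd)
  have h3 := pow_eq_one_of_dvd h2 (pow_eq_one_of_mem_relSeries_two hc h5 hZ _
    (relSeries_antitone (by omega) hda))
  rw [mul_rcomm_pow_eq hZ] at h
  simpa [h1, h1', h3] using h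

variable (h2 : n ∣ n.choose 2) (h4 : n ∣ n.choose 4)
include h2 h4

/-- Expansion of `(x * c) ^ n` for `c ∈ M` when `n`-th powers are central. -/
theorem mul_pow_eq_of_central (x : S) {c : S} (hcM : c ∈ M) :
    (x * c) ^ n = x ^ n * (c ^ n * (icomm c [x, x] ^ n.choose 3 *
      icomm c [x, x, x, x] ^ n.choose 5 * rcomm (rcomm c x) c ^ (2 * n.choose 3) *
      rcomm (icomm c [x, x]) c ^ (2 * n.choose 3))) := by
  have h := mul_pow_eq_of_relSeries hc h5 x hcM n
  have m0 : c ∈ relSeries M 0 := hcM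
  have m1 := rcomm_mem_relSeries m0 x
  have m2 := rcomm_mem_relSeries m1 x
  have k1 := pow_eq_one_of_mem_relSeries_one hc h5 hZ h2
  have e1 := pow_eq_one_of_dvd h2 (k1 _ m1)
  have e2 := pow_eq_one_of_dvd h4 (k1 _ (relSeries_antitone (by omega) (rcomm_mem_relSeries m2 x)))
  have e3 := pow_eq_one_of_dvd h2
    (k1 _ (relSeries_antitone (by omega) (rcomm_mem_relSeries_of_mem hc m1 m0)))
  have e4 := pow_eq_one_of_dvd (h4.mul_left 3)
    (k1 _ (relSeries_antitone (by omega) (rcomm_mem_relSeries_of_mem hc m2 m0)))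
  rw [h]
  simp only [pow_add, icomm_cons, icomm_nil] at *
  rw [e1, e2, e3, e4, mul_one, one_mul, mul_one, one_mul]

/-- For x = a in M the commutators [b, a, a] and [b, a, b] already lie in M_4, where C(n,3) kills.
This reduces the exponent of M to that of its generators. -/
theorem mul_pow_eq_one_of_mem (h35 : ∀ a ∈ relSeries M 3, a ^ n.choose 3 = 1) {a b : S}
    (ha : a ∈ M) (hb : b ∈ M) (han : a ^ n = 1) (hbn : b ^ n = 1) : (a * b) ^ n = 1 := by
  have m0 : b ∈ relSeries M 0 := hb
  have ma : a ∈ relSeries M 0 := ha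
  have m1 := rcomm_mem_relSeries_of_mem hc m0 ma
  have m2 := rcomm_mem_relSeries_of_mem hc m1 ma
  have m2' := rcomm_mem_relSeries_of_mem hc m1 m0
  have e2 := h35 _ (relSeries_antitone (by omega) m2)
  have e3 := h35 _ (relSeries_antitone (by omega) m2')
  have e4 : rcomm (rcomm (rcomm b a) a) b = 1 :=
    eq_one_of_mem_relSeries h5 (by omega) (rcomm_mem_relSeries_of_mem hc m2 m0)
  have e5 : rcomm (rcomm (rcomm b a) a) a = 1 :=
    eq_one_of_mem_relSeries h5 (by omega) (rcomm_mem_relSeries_of_mem hc m2 ma)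
  rw [mul_pow_eq_of_central hc h5 hZ h2 h4 a hb]
  simp [han, hbn, e2, pow_mul', e3, e4, e5]

end CentralPowers

/-! ### The relation [y, x, x, z]^C(n,3) = 1. -/

section CubicRelation

open scoped commutatorElement

variable {S : Type*} [Group S]

theorem eq_one_of_pow_of_coprime {a : S} {m n : ℕ} (h : m.Coprime n) (hm : a ^ m = 1)
    (hn : a ^ n = 1) : a = 1 := by
  rw [← orderOf_eq_one_iff, ← Nat.dvd_one, ← h]
  exact Nat.dvd_gcd (orderOf_dvd_of_pow_eq_one hm) (orderOf_dvd_of_pow_eq_one hn)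

theorem rcomm_inv_left_of_commute {a z : S} (h : Commute (rcomm a z) a) :
    rcomm a⁻¹ z = (rcomm a z)⁻¹ := by
  calc rcomm a⁻¹ z = a * (rcomm a z)⁻¹ * a⁻¹ := by simp only [rcomm]; group
    _ = (rcomm a z)⁻¹ := by rw [← h.inv_left.eq]; group

theorem rcomm_pow_left_of_commute {a z : S} (h : Commute (rcomm a z) a) (k : ℕ) :
    rcomm (a ^ k) z = rcomm a z ^ k := by
  induction k with
  | zero => simp
  | succ k ih =>
    rw [pow_succ, rcomm_mul_left, ih, rcomm_eq_one_iff.2 (h.pow_left k), mul_one, pow_succ]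

variable {M : Subgroup S} [M.Normal]
  (hc : ∀ i j, ⁅relSeries M i, relSeries M j⁆ ≤ relSeries M (i + j + 2)) (h5 : relSeries M 5 = ⊥)
include hc h5

/-- The first commutator is odd in y and the second even; this parity separates the two terms of the
cubic relation. -/
theorem rcomm_rcomm_inv {y : S} (hy : y ∈ M) (x z : S) :
    rcomm (rcomm (rcomm y⁻¹ x) x) z = (rcomm (rcomm (rcomm y x) x) z)⁻¹ ∧
      rcomm (rcomm y⁻¹ x) y⁻¹ = rcomm (rcomm y x) y := by
  have m0 : y ∈ relSeries M 0 := hy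
  have m1 := rcomm_mem_relSeries m0 x
  have m2 := rcomm_mem_relSeries m1 x
  have me := rcomm_mem_relSeries_of_mem hc m1 m0
  have com : ∀ {i j : ℕ} {a b : S}, 5 ≤ i + j + 2 → a ∈ relSeries M i → b ∈ relSeries M j →
      Commute a b := fun h ha hb => commute_of_mem_relSeries hc h5 h ha hb
  have hd : rcomm y⁻¹ x = (rcomm y x)⁻¹ * rcomm (rcomm y x) y := by
    have : rcomm (rcomm y x)⁻¹ y⁻¹ = rcomm (rcomm y x) y := by
      have h := (com (by omega) me m0).mul_right (com (by omega) me m1)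
      calc rcomm (rcomm y x)⁻¹ y⁻¹
          = (y * rcomm y x) * rcomm (rcomm y x) y * (y * rcomm y x)⁻¹ := by
            simp only [rcomm]; group
        _ = rcomm (rcomm y x) y := by rw [← h.eq]; group
    rw [← this]; simp only [rcomm]; group
  have hinv : ∀ w, rcomm (rcomm y⁻¹ x) w =
      rcomm (rcomm y x)⁻¹ w * rcomm (rcomm (rcomm y x) y) w := fun w => by
    rw [hd, rcomm_mul_left, rcomm_eq_one_iff.2 (com (by omega)
      (rcomm_mem_relSeries (inv_mem m1) w) me), mul_one]
  constructor
  · have hcen := mem_center_of_mem_relSeries h5 (by omega) (rcomm_mem_relSeries me x)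
    rw [hinv, rcomm_inv_left_of_commute (com (by omega) m2 m1), rcomm_mul_left,
      rcomm_inv_left_of_commute (com (by omega) (rcomm_mem_relSeries m2 z) m2),
      rcomm_eq_one_iff.2 (Subgroup.mem_center_iff.1 hcen _).symm,
      rcomm_eq_one_iff.2 (Subgroup.mem_center_iff.1 hcen _), mul_one, mul_one]
  · have h1 : rcomm (rcomm (rcomm y x) y) y⁻¹ = 1 :=
      rcomm_eq_one_iff.2 (com (by omega) me m0).inv_right
    rw [hinv, h1, mul_one]
    calc rcomm (rcomm y x)⁻¹ y⁻¹
          = (y * rcomm y x) * rcomm (rcomm y x) y * (y * rcomm y x)⁻¹ := by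
            simp only [rcomm]; group
        _ = rcomm (rcomm y x) y := by
            rw [← ((com (by omega) me m0).mul_right (com (by omega) me m1)).eq]; group

variable {n : ℕ} (hZ : ∀ s : S, s ^ n ∈ Subgroup.center S)
  (h2 : n ∣ n.choose 2) (h4 : n ∣ n.choose 4)
include hZ h2 h4

/-- If `n`-th powers are central and `n ∣ n.choose 5`, then `[y, x, x, z] ^ n.choose 3 = 1`
for `y ∈ M`. -/
theorem icomm_pow_choose_three_eq_one (hn : Odd n) (hn5 : n ∣ n.choose 5) {y : S} (hy : y ∈ M)
    (x z : S) : icomm y [x, x, z] ^ n.choose 3 = 1 := by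
  have k1 := pow_eq_one_of_mem_relSeries_one hc h5 hZ h2
  have key : ∀ y ∈ M, rcomm (rcomm (rcomm y x) x) z ^ n.choose 3 *
      rcomm (rcomm (rcomm y x) y) z ^ (2 * n.choose 3) = 1 := by
    intro y hy
    have m0 : y ∈ relSeries M 0 := hy
    have m1 := rcomm_mem_relSeries m0 x
    have m2 := rcomm_mem_relSeries m1 x
    have m4 := rcomm_mem_relSeries (rcomm_mem_relSeries m2 x) x
    have me := rcomm_mem_relSeries_of_mem hc m1 m0
    have mf := mem_center_of_mem_relSeries h5 (by omega) (rcomm_mem_relSeries_of_mem hc m2 m0)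
    have h := mul_pow_eq_of_central hc h5 hZ h2 h4 x hy
    simp only [icomm_cons, icomm_nil] at h
    rw [pow_eq_one_of_dvd hn5 (k1 _ (relSeries_antitone (by omega) m4)), mul_one, ← mul_assoc,
      ← mul_assoc, ← div_eq_iff_eq_mul, ← inv_mul_eq_iff_eq_mul] at h
    -- In the expansion of (xy)^n all other factors are central, so this product is central too;
    -- commuting it with z gives `key`.
    have hw : rcomm (rcomm y x) x ^ n.choose 3 * rcomm (rcomm y x) y ^ (2 * n.choose 3) ∈
        Subgroup.center S := by
      rw [← h, div_eq_mul_inv]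
      exact mul_mem (inv_mem (mul_mem (hZ _) (hZ _))) (mul_mem (hZ _) (inv_mem (pow_mem mf _)))
    have hw' := rcomm_eq_one_iff.2 (Subgroup.mem_center_iff.1 hw z).symm
    have mz := rcomm_mem_relSeries (pow_mem m2 (n.choose 3)) z
    rwa [rcomm_mul_left, rcomm_eq_one_iff.2 (commute_of_mem_relSeries hc h5 (by omega) mz
      (pow_mem me _)), mul_one,
      rcomm_pow_left_of_commute (commute_of_mem_relSeries hc h5 (by omega)
        (rcomm_mem_relSeries m2 z) m2),
      rcomm_pow_left_of_commute (commute_of_mem_relSeries hc h5 (by omega)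
        (rcomm_mem_relSeries me z) me)] at hw'
  change rcomm (rcomm (rcomm y x) x) z ^ n.choose 3 = 1
  have e1 := key y hy
  have e2 := key y⁻¹ (inv_mem hy)
  obtain ⟨i1, i2⟩ := rcomm_rcomm_inv hc h5 hy x z
  rw [i1, i2, inv_pow, inv_mul_eq_one] at e2
  rw [← e2, ← pow_two] at e1
  refine eq_one_of_pow_of_coprime (Nat.coprime_two_left.2 hn) e1 ?_
  have m3 : rcomm (rcomm (rcomm y x) x) z ∈ relSeries M 3 :=
    rcomm_mem_relSeries (rcomm_mem_relSeries (rcomm_mem_relSeries (k := 0) hy x) x) z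
  rw [← pow_mul, mul_comm, pow_mul, k1 _ (relSeries_antitone (by omega) m3), one_pow]

end CubicRelation

/-! ### Abstract exterior pairings, a notion that passes to quotients of S. -/

open scoped commutatorElement in
/-- A group `S` with a normal subgroup `M`, a homomorphism `ι : G → S` such that `S = M · ι G`, and
a generating family `β s t` of `M` behaving like the symbols `s ∧ t`: the model is
`S = (G ∧ G) ⋊ G`. -/
structure ExteriorPairing (G : Type*) {S : Type*} [Group G] [Group S] (M : Subgroup S) where
  ι : G →* S
  β : G → G → S
  closure_range : Subgroup.closure (Set.range fun st : G × G => β st.1 st.2) = M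
  sup_range : M ⊔ ι.range = ⊤
  mul_left : ∀ s s' t, β (s * s') t = (ι s')⁻¹ * β s t * ι s' * β s' t
  conj : ∀ s t x, (ι x)⁻¹ * β s t * ι x = β (x⁻¹ * s * x) (x⁻¹ * t * x)
  self : ∀ s, β s s = 1
  swap : ∀ s t, β t s = (β s t)⁻¹
  rcomm_left : ∀ s x t, β (rcomm s x) t = rcomm (β s x) (ι t)
  rcomm_β : ∀ y ∈ M, ∀ s t, rcomm y (β s t) = rcomm y (rcomm (ι s) (ι t))

namespace ExteriorPairing

open scoped commutatorElement

variable {G S : Type*} [Group G] [Group S] {M : Subgroup S}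

/-- The image of an exterior pairing under a surjective homomorphism. -/
def map (P : ExteriorPairing G M) {Q : Type*} [Group Q] (f : S →* Q) (hf : Function.Surjective f) :
    ExteriorPairing G (M.map f) where
  ι := f.comp P.ι
  β s t := f (P.β s t)
  closure_range := by
    refine Eq.trans ?_ (congrArg (Subgroup.map f) P.closure_range)
    rw [MonoidHom.map_closure, ← Set.range_comp]
    rfl
  sup_range := by
    rw [MonoidHom.range_comp, ← Subgroup.map_sup, P.sup_range, Subgroup.map_top_of_surjective f hf]
  mul_left s s' t := by simp [P.mul_left]
  conj s t x := by simp [← P.conj]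
  self s := by simp [P.self]
  swap s t := by simp [P.swap s t]
  rcomm_left s x t := by simp [P.rcomm_left, map_rcomm]
  rcomm_β := by
    rintro _ ⟨y, hy, rfl⟩ s t
    rw [← map_rcomm, P.rcomm_β y hy]
    simp [map_rcomm]

variable (P : ExteriorPairing G M)

theorem β_mem (s t : G) : P.β s t ∈ M := by
  have h : P.β s t ∈ Subgroup.closure (Set.range fun st : G × G => P.β st.1 st.2) :=
    Subgroup.subset_closure ⟨(s, t), rfl⟩
  rwa [P.closure_range] at h

theorem mul_right (s t t' : G) : P.β s (t * t') = P.β s t' * ((P.ι t')⁻¹ * P.β s t * P.ι t') := by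
  rw [P.swap (t * t') s, P.mul_left, P.swap s t, P.swap s t']
  group

theorem one_left (t : G) : P.β 1 t = 1 := by
  simpa using P.mul_left 1 1 t

theorem pow_self (y : G) (k : ℕ) : P.β (y ^ k) y = 1 := by
  induction k with
  | zero => simp [P.one_left]
  | succ k ih => simp [pow_succ, P.mul_left, P.self, ih]

theorem mul_pow_left (x y : G) (k : ℕ) :
    P.β (x * y ^ k) y = P.β x y * rcomm (P.β x y) (P.ι (y ^ k)) := by
  rw [P.mul_left, P.pow_self, mul_one, conj_eq_mul_rcomm]

/-- A lift of (x[x, y])^k = x^k [x^k, y]; with x^k = 1 it makes the left side trivial, which is the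
source of the bound on (x ∧ y)^n. -/
theorem pow_left (x y : G) (k : ℕ) :
    (P.ι x * P.β x y) ^ k = P.ι x ^ k * P.β (x ^ k) y := by
  induction k with
  | zero => simp [P.one_left]
  | succ k ih =>
    rw [pow_succ' (_ * _), ih, pow_succ' x, P.mul_left, pow_succ', map_pow]
    group

-- β s t and [ι s, ι t] act alike on M by conjugation, so they differ by an element centralizing M.
include P in
theorem le_commutator_sup_centralizer :
    M ≤ ⁅(⊤ : Subgroup S), ⊤⁆ ⊔ Subgroup.centralizer (M : Set S) := by
  refine P.closure_range.symm.trans_le ((Subgroup.closure_le _).2 ?_)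
  rintro _ ⟨⟨s, t⟩, rfl⟩
  have h : P.β s t = P.β s t * (rcomm (P.ι s) (P.ι t))⁻¹ * rcomm (P.ι s) (P.ι t) := by group
  change P.β s t ∈ _
  rw [h]
  refine mul_mem (Subgroup.mem_sup_right ?_) (Subgroup.mem_sup_left ?_)
  · refine Subgroup.mem_centralizer_iff.2 fun y hy => ?_
    have h1 := P.rcomm_β y hy s t
    set b := P.β s t
    set c := rcomm (P.ι s) (P.ι t)
    have h2 : b⁻¹ * y * b = c⁻¹ * y * c := by
      rw [conj_eq_mul_rcomm, conj_eq_mul_rcomm, h1]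
    calc y * (b * c⁻¹) = b * (b⁻¹ * y * b) * c⁻¹ := by group
      _ = b * c⁻¹ * y := by rw [h2]; group
  · rw [rcomm_eq_commutatorElement]
    exact Subgroup.commutator_mem_commutator (Subgroup.mem_top _) (Subgroup.mem_top _)

include P in
theorem commutator_le [M.Normal] (i j : ℕ) :
    ⁅relSeries M i, relSeries M j⁆ ≤ relSeries M (i + j + 2) :=
  commutator_relSeries_le P.le_commutator_sup_centralizer i j

end ExteriorPairing

/-! ### Vanishing of [M, S, S] in the alternating case. -/

namespace ExteriorPairing

open scoped commutatorElement

variable {G S : Type*} [Group G] [Group S] {M : Subgroup S} [M.Normal]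

section Alternating

variable (h3 : relSeries M 3 = ⊥) (hE : ∀ y ∈ M, ∀ x, icomm y [x, x] = 1)
include h3

theorem icomm_pair_mem_center {y : S} (hy : y ∈ M) (a b : S) :
    icomm y [a, b] ∈ Subgroup.center S :=
  mem_center_of_mem_relSeries h3 (k := 2) le_rfl (icomm_mem_relSeries (k := 0) hy [a, b])

theorem icomm_mul_first {y : S} (hy : y ∈ M) (a b u : S) :
    icomm y [a * b, u] = icomm y [a, u] * icomm y [b, u] :=
  icomm_mul_cons h3 (k := 0) hy a b [u] le_rfl

theorem icomm_mul_second {y : S} (hy : y ∈ M) (a b u : S) :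
    icomm y [u, a * b] = icomm y [u, a] * icomm y [u, b] :=
  icomm_mul_slot h3 (k := 0) hy [u] a b [] le_rfl

include hE

theorem icomm_swap {y : S} (hy : y ∈ M) (a b : S) : icomm y [a, b] = (icomm y [b, a])⁻¹ := by
  have h := hE y hy (a * b)
  rw [icomm_mul_first h3 hy, icomm_mul_second h3 hy, icomm_mul_second h3 hy, hE y hy, hE y hy,
    one_mul, mul_one] at h
  exact eq_inv_of_mul_eq_one_left h

variable (P : ExteriorPairing G M)
include P

/-- Comparing the expansions of [y, ab] and [y, ba[a, b]] gives [y, [a, b]] = [y, a, b][y, b, a]⁻¹,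
a square by antisymmetry. -/
theorem rcomm_rcomm_eq_sq {y : S} (hy : y ∈ M) (a b : S) :
    rcomm y (rcomm a b) = icomm y [a, b] ^ 2 := by
  have m0 : y ∈ relSeries M 0 := hy
  have com : ∀ c d, Commute (rcomm y c) (rcomm y d) := fun c d =>
    commute_of_mem_relSeries P.commutator_le h3 (by omega) (rcomm_mem_relSeries m0 c)
      (rcomm_mem_relSeries m0 d)
  have cen : ∀ c d (z : S), z * icomm y [c, d] = icomm y [c, d] * z := fun c d =>
    Subgroup.mem_center_iff.1 (icomm_pair_mem_center h3 hy c d)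
  have hab : a * b = b * a * rcomm a b := by simp only [rcomm]; group
  have hkill : icomm y [b * a, rcomm a b] = 1 := by
    have h := icomm_mul_second h3 hy a b (b * a)
    rwa [hab, icomm_mul_second h3 hy, icomm_mul_second h3 hy, cen _ _ (icomm y [b * a, b]),
      mul_eq_left] at h
  have h1 := rcomm_mul_right y a b
  have h2 := rcomm_mul_right y b a
  have h4 := rcomm_mul_right y (b * a) (rcomm a b)
  have h5 := icomm_swap h3 hE hy b a
  have c1 := cen a b
  have c2 := cen b a
  simp only [icomm_cons, icomm_nil] at *
  rw [hkill, mul_one, ← hab, h1, h2, h5, (com b a).eq] at h4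
  rw [mul_inv_eq_of_eq_mul h4 |>.symm, mul_inv_rev, inv_inv]
  have c := c1 (rcomm y a * rcomm y b)
  rw [pow_two, c, mul_assoc, ← mul_assoc _ (rcomm (rcomm y a) b), c]
  group

theorem rcomm_rcomm_mem_center {y : S} (hy : y ∈ M) (a b : S) :
    rcomm y (rcomm a b) ∈ Subgroup.center S := by
  rw [rcomm_rcomm_eq_sq h3 hE P hy]
  exact pow_mem (icomm_pair_mem_center h3 hy a b) 2

/-- The Hall–Witt identity modulo central elements. -/
theorem icomm_β_jacobi (s t x : G) (u : S) :
    icomm (P.β s t) [P.ι x, u] =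
      icomm (P.β s x) [P.ι t, u] * (icomm (P.β t x) [P.ι s, u])⁻¹ := by
  have m1 : ∀ {y : S}, y ∈ M → ∀ z, rcomm y z ∈ relSeries M 1 := fun hy z =>
    rcomm_mem_relSeries (k := 0) hy z
  have z2 : ∀ {y : S}, y ∈ relSeries M 1 → ∀ z, rcomm y z ∈ Subgroup.center S := fun hy z =>
    mem_center_of_mem_relSeries h3 (k := 2) le_rfl (rcomm_mem_relSeries hy z)
  set E := rcomm (P.β t x) (P.ι s) with hEdef
  set F := rcomm (P.β s x) (P.ι t) with hFdef
  set D := rcomm (P.β s t) (P.ι x) with hDdef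
  have hEm : E ∈ relSeries M 1 := m1 (P.β_mem _ _) _
  have hFm : F ∈ relSeries M 1 := m1 (P.β_mem _ _) _
  have hDm : D ∈ relSeries M 1 := m1 (P.β_mem _ _) _
  have hs : x⁻¹ * s * x = s * rcomm s x := conj_eq_mul_rcomm _ _
  have ht : x⁻¹ * t * x = t * rcomm t x := conj_eq_mul_rcomm _ _
  obtain ⟨X, c₁, hX, hc₁, hXM⟩ : ∃ X c₁, P.β s (t * rcomm t x) = X ∧ c₁ ∈ Subgroup.center S ∧
      X = E⁻¹ * (P.β s t * c₁) :=
    ⟨_, _, rfl, rcomm_rcomm_mem_center h3 hE P (P.β_mem s t) (P.ι t) (P.ι x), by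
      rw [P.mul_right, P.swap (rcomm t x), P.rcomm_left, conj_eq_mul_rcomm, map_rcomm]⟩
  obtain ⟨c₂, hc₂, hX₂⟩ : ∃ c₂ ∈ Subgroup.center S,
      (P.ι (rcomm s x))⁻¹ * X * P.ι (rcomm s x) = X * c₂ :=
    ⟨_, rcomm_rcomm_mem_center h3 hE P (hX ▸ P.β_mem s (t * rcomm t x)) (P.ι s) (P.ι x), by
      rw [conj_eq_mul_rcomm, map_rcomm]⟩
  obtain ⟨c₃, hc₃, hX₃⟩ : ∃ c₃ ∈ Subgroup.center S,
      P.β (rcomm s x) (t * rcomm t x) = F * c₃ :=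
    ⟨rcomm F (rcomm (P.ι t) (P.ι x)) * rcomm (P.β s x) (rcomm (P.ι t) (P.ι x)),
      mul_mem (z2 hFm _) (rcomm_rcomm_mem_center h3 hE P (P.β_mem s x) (P.ι t) (P.ι x)), by
      rw [P.mul_right, P.rcomm_left, P.rcomm_left, conj_eq_mul_rcomm, map_rcomm, ← hFdef,
        ← Subgroup.mem_center_iff.1 (rcomm_rcomm_mem_center h3 hE P (P.β_mem s x) (P.ι t) (P.ι x))
          (F * _), mul_assoc]⟩
  -- β(s[s, x], t[t, x]) = β(s, t)[β(s, t), x] is expanded in both slots; conjugations by [s, x] and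
  -- [t, x] contribute only central factors.
  have hconj := P.conj s t x
  rw [conj_eq_mul_rcomm, hs, ht, P.mul_left, hX, hX₂, hX₃, hXM] at hconj
  have hEβ : Commute E⁻¹ (P.β s t) := (commute_of_mem_relSeries P.commutator_le h3 (by omega) hEm
    (show P.β s t ∈ relSeries M 0 from P.β_mem s t)).inv_left
  have hD : D = E⁻¹ * F * (c₁ * c₂ * c₃) := by
    apply mul_left_cancel (a := P.β s t)
    rw [hconj]
    calc E⁻¹ * (P.β s t * c₁) * c₂ * (F * c₃) = E⁻¹ * P.β s t * (c₁ * c₂ * F) * c₃ := by group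
      _ = _ := by
        rw [hEβ.eq, ← Subgroup.mem_center_iff.1 (mul_mem hc₁ hc₂) F]; group
  have hc : c₁ * c₂ * c₃ ∈ Subgroup.center S := mul_mem (mul_mem hc₁ hc₂) hc₃
  have hcm : c₁ * c₂ * c₃ = (E⁻¹ * F)⁻¹ * D := by rw [hD]; group
  have hEF : E⁻¹ * F ∈ relSeries M 1 := mul_mem (inv_mem hEm) hFm
  have hcR : c₁ * c₂ * c₃ ∈ relSeries M 1 := hcm ▸ mul_mem (inv_mem hEF) hDm
  change icomm D [u] = icomm F [u] * (icomm E [u])⁻¹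
  rw [hD, icomm_mul h3 hEF hcR [u] le_rfl, icomm_mul h3 (inv_mem hEm) hFm [u] le_rfl,
    icomm_inv h3 hEm [u] le_rfl,
    show icomm (c₁ * c₂ * c₃) [u] = 1 from
      rcomm_eq_one_iff.2 (Subgroup.mem_center_iff.1 hc u).symm, mul_one]
  exact Subgroup.mem_center_iff.1 (z2 hFm u) _

/-- If `[y, x, x] = 1` for all `y ∈ M`, `[M, S, S, S] = 1` and `[M, S, S]` has no 2-torsion, then
`[M, S, S] = 1`. -/
theorem relSeries_two_eq_bot (h2 : ∀ a ∈ relSeries M 2, a ^ 2 = 1 → a = 1) :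
    relSeries M 2 = ⊥ := by
  have mem : ∀ s t (x u : G), icomm (P.β s t) [P.ι x, P.ι u] ∈ relSeries M 2 := fun s t x u =>
    icomm_mem_relSeries (k := 0) (P.β_mem s t) [P.ι x, P.ι u]
  have cen : ∀ s t (x u : G) (z : S), z * icomm (P.β s t) [P.ι x, P.ι u] =
      icomm (P.β s t) [P.ι x, P.ι u] * z := fun s t x u =>
    Subgroup.mem_center_iff.1 (icomm_pair_mem_center h3 (P.β_mem s t) _ _)
  -- The squares of both sides are [β s t, β x u] and the inverse of [β x u, β s t].
  have pair : ∀ s t x u, icomm (P.β s t) [P.ι x, P.ι u] =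
      (icomm (P.β x u) [P.ι s, P.ι t])⁻¹ := by
    intro s t x u
    have key : ∀ s t x u, rcomm (P.β s t) (P.β x u) = icomm (P.β s t) [P.ι x, P.ι u] ^ 2 :=
      fun s t x u => by
        rw [P.rcomm_β _ (P.β_mem s t), rcomm_rcomm_eq_sq h3 hE P (P.β_mem s t)]
    have h := rcomm_inv (P.β x u) (P.β s t)
    rw [key, key] at h
    refine eq_inv_of_mul_eq_one_left (h2 _ (mul_mem (mem _ _ _ _) (mem _ _ _ _)) ?_)
    rw [Commute.mul_pow (cen x u s t _), ← h, inv_mul_cancel]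
  -- Write f(st; xu) for the element. Jacobi for (x, u) and for (u, x), with `pair`, gives f(st; xu)
  -- = f(st; ux), while f is also antisymmetric in x, u.
  have triv : ∀ s t x u, icomm (P.β s t) [P.ι x, P.ι u] = 1 := by
    intro s t x u
    have e1 := icomm_β_jacobi h3 hE P s t x (P.ι u)
    have e2 := icomm_β_jacobi h3 hE P s t u (P.ι x)
    rw [pair s u t x, pair t u s x, inv_inv, icomm_swap h3 hE (P.β_mem s t),
      cen, ← e1, inv_eq_iff_mul_eq_one, ← pow_two] at e2
    exact h2 _ (mem _ _ _ _) e2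
  -- It remains to pass from generators to all of M and S, using S = M · ι G and [M, [M, S]] ≤ M_3 =
  -- 1.
  have c1 : ∀ s t x, rcomm (P.β s t) (P.ι x) ∈ Subgroup.center S := by
    intro s t x
    have hm : rcomm (P.β s t) (P.ι x) ∈ relSeries M 1 :=
      rcomm_mem_relSeries (k := 0) (P.β_mem s t) _
    have : M ⊔ P.ι.range ≤ Subgroup.centralizer {rcomm (P.β s t) (P.ι x)} := by
      refine sup_le (fun y hy => ?_) ?_
      · exact Subgroup.mem_centralizer_singleton_iff.2
          (commute_of_mem_relSeries P.commutator_le h3 (i := 0) (j := 1) le_rfl hy hm)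
      · rintro _ ⟨u, rfl⟩
        exact Subgroup.mem_centralizer_singleton_iff.2 (rcomm_eq_one_iff.1 (triv s t x u)).symm
    rw [P.sup_range] at this
    exact Subgroup.mem_center_iff.2 fun z =>
      Subgroup.mem_centralizer_singleton_iff.1 (this (Subgroup.mem_top z))
  have c2 : ∀ s t z, rcomm (P.β s t) z ∈ Subgroup.center S := by
    intro s t z
    have hz : z ∈ M ⊔ P.ι.range := P.sup_range ▸ Subgroup.mem_top z
    obtain ⟨y, hy, _, ⟨g, rfl⟩, rfl⟩ := Subgroup.mem_sup_of_normal_left.1 hz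
    rw [rcomm_mul_right]
    have h' : rcomm (P.β s t) y ∈ Subgroup.center S :=
      mem_center_of_mem_relSeries h3 (k := 2) le_rfl
        (rcomm_mem_relSeries_of_mem P.commutator_le (i := 0) (j := 0) (P.β_mem s t) hy)
    rw [rcomm_eq_one_iff.2 (Subgroup.mem_center_iff.1 h' (P.ι g)).symm, mul_one]
    exact mul_mem (c1 s t g) h'
  have c3 : ∀ y ∈ M, ∀ z, rcomm y z ∈ Subgroup.center S := by
    intro y hy
    replace hy : y ∈ Subgroup.closure (Set.range fun st : G × G => P.β st.1 st.2) :=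
      P.closure_range.symm ▸ hy
    induction hy using Subgroup.closure_induction with
    | mem y h =>
      obtain ⟨⟨s, t⟩, rfl⟩ := h
      exact c2 s t
    | one => simp [one_mem]
    | mul a b _ _ ha hb =>
      intro z
      rw [rcomm_mul_left, rcomm_eq_one_iff.2 (Subgroup.mem_center_iff.1 (ha z) b).symm, mul_one]
      exact mul_mem (ha z) (hb z)
    | inv a _ ha =>
      intro z
      rw [rcomm_inv_left_of_commute (Subgroup.mem_center_iff.1 (ha z) a).symm]
      exact inv_mem (ha z)
  have c4 : relSeries M 1 ≤ Subgroup.center S := relSeries_succ_le_iff.2 c3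
  rw [eq_bot_iff]
  exact relSeries_succ_le_iff.2 fun a ha x => Subgroup.mem_bot.2
    (rcomm_eq_one_iff.2 (Subgroup.mem_center_iff.1 (c4 ha) x).symm)

end Alternating

end ExteriorPairing

/-! ### Finite differences of multilinear forms along x, xy, xy², …. -/

section FiniteDifference

variable {S A : Type*} [Group S] [AddCommGroup A]

theorem second_difference {F : S → S → A} (h₁ : ∀ a b c, F (a * b) c = F a c + F b c)
    (h₂ : ∀ a b c, F a (b * c) = F a b + F a c) (x y : S) :
    F x x - 2 • F (x * y) (x * y) + F (x * y ^ 2) (x * y ^ 2) = 2 • F y y := by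
  simp only [pow_succ, pow_zero, one_mul, h₁, h₂]
  abel

theorem fourth_difference {F : S → S → S → S → A}
    (h₁ : ∀ a b c d e, F (a * b) c d e = F a c d e + F b c d e)
    (h₂ : ∀ a b c d e, F a (b * c) d e = F a b d e + F a c d e)
    (h₃ : ∀ a b c d e, F a b (c * d) e = F a b c e + F a b d e)
    (h₄ : ∀ a b c d e, F a b c (d * e) = F a b c d + F a b c e) (x y : S) :
    F x x x x - 4 • F (x * y) (x * y) (x * y) (x * y) +
      6 • F (x * y ^ 2) (x * y ^ 2) (x * y ^ 2) (x * y ^ 2) -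
      4 • F (x * y ^ 3) (x * y ^ 3) (x * y ^ 3) (x * y ^ 3) +
      F (x * y ^ 4) (x * y ^ 4) (x * y ^ 4) (x * y ^ 4) = 24 • F y y y y := by
  have p₁ : ∀ (k : ℕ) b c d, F (y ^ (k + 1)) b c d = (k + 1) • F y b c d := by
    intro k b c d
    induction k with
    | zero => simp
    | succ k ih => rw [pow_succ, h₁, ih, ← succ_nsmul]
  have p₂ : ∀ (k : ℕ) b c d, F b (y ^ (k + 1)) c d = (k + 1) • F b y c d := by
    intro k b c d
    induction k with
    | zero => simp
    | succ k ih => rw [pow_succ, h₂, ih, ← succ_nsmul]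
  have p₃ : ∀ (k : ℕ) b c d, F b c (y ^ (k + 1)) d = (k + 1) • F b c y d := by
    intro k b c d
    induction k with
    | zero => simp
    | succ k ih => rw [pow_succ, h₃, ih, ← succ_nsmul]
  have p₄ : ∀ (k : ℕ) b c d, F b c d (y ^ (k + 1)) = (k + 1) • F b c d y := by
    intro k b c d
    induction k with
    | zero => simp
    | succ k ih => rw [pow_succ, h₄, ih, ← succ_nsmul]
  -- A quartic polynomial in k + 1 with leading coefficient F(y, y, y, y), whence 4! = 24.
  have q : ∀ k : ℕ, F (x * y ^ (k + 1)) (x * y ^ (k + 1)) (x * y ^ (k + 1)) (x * y ^ (k + 1)) =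
      F x x x x + (k + 1) • (F x x x y + F x x y x + F x y x x + F y x x x) +
      (k + 1) ^ 2 • (F x x y y + F x y x y + F x y y x + F y x x y + F y x y x + F y y x x) +
      (k + 1) ^ 3 • (F x y y y + F y x y y + F y y x y + F y y y x) +
      (k + 1) ^ 4 • F y y y y := by
    intro k
    simp only [h₁, h₂, h₃, h₄, p₁, p₂, p₃, p₄]
    module
  have q0 := q 0
  rw [zero_add, pow_one] at q0
  rw [q0, q 1, q 2, q 3]
  module

end FiniteDifference

theorem map_icomm {S Q : Type*} [Group S] [Group Q] (f : S →* Q) (a : S) (xs : List S) :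
    f (icomm a xs) = icomm (f a) (xs.map f) := by
  induction xs generalizing a with
  | nil => rfl
  | cons x xs ih => rw [icomm_cons, ih, map_rcomm]; rfl

/-! ### The two divisibility cases. -/

namespace ExteriorPairing

variable {G S : Type*} [Group G] [Group S] {M : Subgroup S} [M.Normal]

/-- Modulo N = Z(S) M_3 the hypothesis becomes [y, x, x] = 1, so the alternating case yields M_2 ≤
Z(S) M_3. Commuting with S gives M_3 ≤ M_4, hence M_4 ≤ M_5 = 1. -/
theorem relSeries_three_eq_bot (P : ExteriorPairing G M) (h5 : relSeries M 5 = ⊥)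
    (hE : ∀ y ∈ M, ∀ x z, icomm y [x, x, z] = 1) {n : ℕ} (hn : Odd n)
    (htor : ∀ a ∈ relSeries M 2, a ^ n = 1) : relSeries M 3 = ⊥ := by
  let N : Subgroup S := Subgroup.center S ⊔ relSeries M 3
  let f := QuotientGroup.mk' N
  have hf : Function.Surjective f := QuotientGroup.mk'_surjective N
  have hker : ∀ X : Subgroup S, X.map f = ⊥ ↔ X ≤ N := fun X => by
    rw [Subgroup.map_eq_bot_iff, QuotientGroup.ker_mk']
  have : (M.map f).Normal := Subgroup.Normal.map inferInstance f hf
  have h2 : relSeries M 2 ≤ N := by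
    rw [← hker, map_relSeries hf]
    refine relSeries_two_eq_bot ?_ ?_ (P.map f hf) ?_
    · rw [← map_relSeries hf, hker]
      exact le_sup_right
    · rintro _ ⟨y, hy, rfl⟩ x
      obtain ⟨x, rfl⟩ := hf x
      have := map_icomm f y [x, x]
      rw [List.map_cons, List.map_cons, List.map_nil] at this
      rw [← this]
      refine (QuotientGroup.eq_one_iff _).2 (Subgroup.mem_sup_left (Subgroup.mem_center_iff.2 ?_))
      exact fun z => (rcomm_eq_one_iff.1 (hE y hy x z)).symm
    · rw [← map_relSeries hf]
      rintro _ ⟨a, ha, rfl⟩ h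
      refine eq_one_of_pow_of_coprime (Nat.coprime_two_left.2 hn) h ?_
      rw [← map_pow, htor a ha, map_one]
  have h34 : relSeries M 3 ≤ relSeries M 4 := by
    refine relSeries_succ_le_iff.2 fun a ha x => ?_
    obtain ⟨c, hcc, r, hr, rfl⟩ := Subgroup.mem_sup_of_normal_right.1 (h2 ha)
    rw [rcomm_mul_left, rcomm_eq_one_iff.2 (Subgroup.mem_center_iff.1 hcc x).symm, rcomm_one_left,
      one_mul, one_mul]
    exact rcomm_mem_relSeries hr x
  have h4 : relSeries M 4 ≤ ⊥ := relSeries_succ_le_iff.2 fun a ha x =>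
    h5 ▸ rcomm_mem_relSeries (h34 ha) x
  exact eq_bot_iff.2 (h34.trans h4)

variable (P : ExteriorPairing G M) (h5 : relSeries M 5 = ⊥) {n : ℕ}
  (hZ : ∀ s : S, s ^ n ∈ Subgroup.center S) (hG : ∀ g : G, g ^ n = 1) (hn : Odd n)
  (h2 : n ∣ n.choose 2) (h4 : n ∣ n.choose 4)
include P h5 hZ h2 h4

include hG in
theorem β_pow_mul_eq_one (x y : G) :
    P.β x y ^ n * (icomm (P.β x y) [P.ι x, P.ι x] ^ n.choose 3 *
      icomm (P.β x y) [P.ι x, P.ι x, P.ι x, P.ι x] ^ n.choose 5 *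
      rcomm (rcomm (P.β x y) (P.ι x)) (P.β x y) ^ (2 * n.choose 3) *
      rcomm (icomm (P.β x y) [P.ι x, P.ι x]) (P.β x y) ^ (2 * n.choose 3)) = 1 := by
  have h := mul_pow_eq_of_central P.commutator_le h5 hZ h2 h4 (P.ι x) (P.β_mem x y)
  rw [P.pow_left, ← map_pow, hG, P.one_left, map_one, mul_one, one_mul] at h
  exact h.symm

theorem pow_eq_one_of_β_pow (h3 : ∀ a ∈ relSeries M 3, a ^ n.choose 3 = 1)
    (hβ : ∀ x y, P.β x y ^ n = 1) : ∀ a ∈ M, a ^ n = 1 := by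
  let N : Subgroup S :=
    { carrier := {a | a ∈ M ∧ a ^ n = 1}
      one_mem' := ⟨one_mem _, one_pow _⟩
      inv_mem' := fun {a} ha => ⟨inv_mem ha.1, by rw [inv_pow, ha.2, inv_one]⟩
      mul_mem' := fun {a b} ha hb => ⟨mul_mem ha.1 hb.1,
        mul_pow_eq_one_of_mem P.commutator_le h5 hZ h2 h4 h3 ha.1 hb.1 ha.2 hb.2⟩ }
  have : M ≤ N := by
    refine P.closure_range.symm.trans_le ((Subgroup.closure_le _).2 ?_)
    rintro _ ⟨⟨s, t⟩, rfl⟩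
    exact ⟨P.β_mem s t, hβ s t⟩
  exact fun a ha => (this ha).2

-- The quartic case, where only the C(n,5) error term survives.
include hG in
theorem pow_eq_one_of_dvd_choose_three (h24 : Nat.Coprime 24 n) (h3 : n ∣ n.choose 3) :
    ∀ a ∈ M, a ^ n = 1 := by
  have k1 := pow_eq_one_of_mem_relSeries_one P.commutator_le h5 hZ h2
  refine P.pow_eq_one_of_β_pow h5 hZ h2 h4
    (fun a ha => pow_eq_one_of_dvd h3 (k1 a (relSeries_antitone (by omega) ha))) fun x y => ?_
  have R : ∀ x y, P.β x y ^ n *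
      icomm (P.β x y) [P.ι x, P.ι x, P.ι x, P.ι x] ^ n.choose 5 = 1 := by
    intro x y
    have h := P.β_pow_mul_eq_one h5 hZ hG h2 h4 x y
    have m0 : P.β x y ∈ relSeries M 0 := P.β_mem x y
    have m1 := rcomm_mem_relSeries m0 (P.ι x)
    have m2 := rcomm_mem_relSeries m1 (P.ι x)
    simp only [icomm_cons, icomm_nil] at h
    rwa [pow_eq_one_of_dvd h3 (k1 _ (relSeries_antitone (by omega) m2)),
      pow_eq_one_of_dvd (h3.mul_left 2) (k1 _ (relSeries_antitone (by omega)
        (rcomm_mem_relSeries m1 (P.β x y)))),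
      pow_eq_one_of_dvd (h3.mul_left 2) (k1 _ (relSeries_antitone (by omega)
        (rcomm_mem_relSeries m2 (P.β x y)))), one_mul, mul_one, mul_one] at h
  have R' : ∀ x y, icomm (P.β x y) [P.ι x, P.ι x, P.ι x, P.ι x] ^ n.choose 5 =
      icomm (P.β x y) [P.ι y, P.ι y, P.ι y, P.ι y] ^ n.choose 5 := by
    intro x y
    have e1 := R x y
    have e2 := R y x
    rw [P.swap x y, icomm_inv h5 (k := 0) (P.β_mem x y) _ le_rfl, inv_pow, inv_pow,
      ← mul_inv_rev, inv_eq_one] at e2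
    rw [eq_inv_of_mul_eq_one_right e1, eq_inv_of_mul_eq_one_left e2]
  -- `R'` is applied to (xy^k, y); β(xy^k, y) may be replaced by β(x, y), since they differ by an
  -- element of M_1 and four further commutators reach M_5.
  have R'' : ∀ k : ℕ, icomm (P.β x y) [P.ι x * P.ι y ^ k, P.ι x * P.ι y ^ k, P.ι x * P.ι y ^ k,
      P.ι x * P.ι y ^ k] ^ n.choose 5 =
      icomm (P.β x y) [P.ι y, P.ι y, P.ι y, P.ι y] ^ n.choose 5 := by
    intro k
    have hm : rcomm (P.β x y) (P.ι (y ^ k)) ∈ relSeries M 1 :=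
      rcomm_mem_relSeries (k := 0) (P.β_mem x y) _
    have drop : ∀ z, icomm (P.β (x * y ^ k) y) [z, z, z, z] = icomm (P.β x y) [z, z, z, z] :=
      fun z => by
        rw [P.mul_pow_left, icomm_mul h5 (k := 0) (P.β_mem x y) (relSeries_succ_le 0 hm) _ le_rfl,
          icomm_eq_one h5 hm _ le_rfl, mul_one]
    have h := R' (x * y ^ k) y
    rwa [drop, drop, map_mul, map_pow] at h
  let c := P.β x y
  have hc : c ∈ relSeries M 0 := P.β_mem x y
  let _ : CommGroup (Subgroup.center S) :=
    { mul_comm := fun a b => Subtype.ext (Subgroup.mem_center_iff.1 b.2 a) }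
  let F : S → S → S → S → Additive (Subgroup.center S) := fun a₁ a₂ a₃ a₄ => Additive.ofMul
    ⟨icomm c [a₁, a₂, a₃, a₄],
      mem_center_of_mem_relSeries h5 (k := 4) le_rfl (icomm_mem_relSeries hc [a₁, a₂, a₃, a₄])⟩
  have hF := fourth_difference (F := F)
    (fun a b a₂ a₃ a₄ => congrArg Additive.ofMul (Subtype.ext
      (icomm_mul_slot h5 hc [] a b [a₂, a₃, a₄] le_rfl)))
    (fun a₁ a b a₃ a₄ => congrArg Additive.ofMul (Subtype.ext
      (icomm_mul_slot h5 hc [a₁] a b [a₃, a₄] le_rfl)))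
    (fun a₁ a₂ a b a₄ => congrArg Additive.ofMul (Subtype.ext
      (icomm_mul_slot h5 hc [a₁, a₂] a b [a₄] le_rfl)))
    (fun a₁ a₂ a₃ a b => congrArg Additive.ofMul (Subtype.ext
      (icomm_mul_slot h5 hc [a₁, a₂, a₃] a b [] le_rfl))) (P.ι x) (P.ι y)
  have hk : ∀ k : ℕ, n.choose 5 • F (P.ι x * P.ι y ^ k) (P.ι x * P.ι y ^ k) (P.ι x * P.ι y ^ k)
      (P.ι x * P.ι y ^ k) = n.choose 5 • F (P.ι y) (P.ι y) (P.ι y) (P.ι y) := fun k =>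
    congrArg Additive.ofMul (Subtype.ext (R'' k))
  have hk0 := hk 0
  have hk1 := hk 1
  rw [pow_zero, mul_one] at hk0
  rw [pow_one] at hk1
  -- The values at xy^k coincide and 1 − 4 + 6 − 4 + 1 = 0.
  have h0 : 24 • (n.choose 5 • F (P.ι y) (P.ι y) (P.ι y) (P.ι y)) = 0 := by
    rw [smul_smul, mul_comm, mul_smul, ← hF]
    simp only [smul_add, smul_sub, smul_comm (n.choose 5) (_ : ℕ) (F _ _ _ _), hk0, hk1, hk]
    module
  have h24' : (icomm c [P.ι y, P.ι y, P.ι y, P.ι y] ^ n.choose 5) ^ 24 = 1 :=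
    congrArg (fun z : Additive (Subgroup.center S) => ((Additive.toMul z : Subgroup.center S) : S)) h0
  have hI := eq_one_of_pow_of_coprime h24 h24' (by
    rw [pow_right_comm, k1 _ (relSeries_antitone (show 1 ≤ 0 + 4 by omega)
      (icomm_mem_relSeries hc [P.ι y, P.ι y, P.ι y, P.ι y])), one_pow])
  have h := R x y
  rwa [R', hI, mul_one] at h

include hn

/-- The cubic Engel-type relations when `n ∣ n.choose 5`. -/
theorem relSeries_three_pow_eq_one (h5' : n ∣ n.choose 5) :
    ∀ a ∈ relSeries M 3, a ^ n.choose 3 = 1 := by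
  -- Modulo T, relations in M_2 that hold after raising to the power C(n,3) hold outright.
  let T := (relSeries M 2).torsionOf (commute_of_mem_relSeries_two P.commutator_le h5) (n.choose 3)
  let f := QuotientGroup.mk' T
  have hf : Function.Surjective f := QuotientGroup.mk'_surjective T
  have : (M.map f).Normal := Subgroup.Normal.map inferInstance f hf
  have h : relSeries (M.map f) 3 = ⊥ := by
    refine relSeries_three_eq_bot (P.map f hf) ?_ ?_ hn ?_
    · rw [← map_relSeries hf, h5, Subgroup.map_bot]
    · rintro _ ⟨y, hy, rfl⟩ x z
      obtain ⟨x, rfl⟩ := hf x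
      obtain ⟨z, rfl⟩ := hf z
      have h := map_icomm f y [x, x, z]
      rw [List.map_cons, List.map_cons, List.map_cons, List.map_nil] at h
      rw [← h]
      refine (QuotientGroup.eq_one_iff _).2 ⟨relSeries_antitone (show 2 ≤ 0 + 3 by omega)
        (icomm_mem_relSeries (k := 0) hy [x, x, z]), ?_⟩
      exact icomm_pow_choose_three_eq_one P.commutator_le h5 hZ h2 h4 hn h5' hy x z
    · rw [← map_relSeries hf]
      rintro _ ⟨a, ha, rfl⟩
      rw [← map_pow, pow_eq_one_of_mem_relSeries_two P.commutator_le h5 hZ a ha, map_one]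
  rw [← map_relSeries hf, Subgroup.map_eq_bot_iff, QuotientGroup.ker_mk'] at h
  exact fun a ha => (h ha).2

-- The quadratic case. In S/T the image of M_3 is trivial, so [c, a, b] is bilinear there and second
-- differences suffice.
include hG in
theorem pow_eq_one_of_dvd_choose_five (h5' : n ∣ n.choose 5) : ∀ a ∈ M, a ^ n = 1 := by
  have k1 := pow_eq_one_of_mem_relSeries_one P.commutator_le h5 hZ h2
  have k3 := P.relSeries_three_pow_eq_one h5 hZ hn h2 h4 h5'
  refine P.pow_eq_one_of_β_pow h5 hZ h2 h4 k3 fun x y => ?_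
  have R : ∀ x y, P.β x y ^ n * icomm (P.β x y) [P.ι x, P.ι x] ^ n.choose 3 = 1 := by
    intro x y
    have h := P.β_pow_mul_eq_one h5 hZ hG h2 h4 x y
    have m0 : P.β x y ∈ relSeries M 0 := P.β_mem x y
    have m1 := rcomm_mem_relSeries m0 (P.ι x)
    have m2 := rcomm_mem_relSeries m1 (P.ι x)
    have m4 := rcomm_mem_relSeries (rcomm_mem_relSeries m2 (P.ι x)) (P.ι x)
    simp only [icomm_cons, icomm_nil, pow_mul'] at h
    rwa [pow_eq_one_of_dvd h5' (k1 _ (relSeries_antitone (by omega) m4)),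
      k3 _ (relSeries_antitone (by omega) (rcomm_mem_relSeries_of_mem P.commutator_le m1 m0)),
      k3 _ (relSeries_antitone (by omega) (rcomm_mem_relSeries_of_mem P.commutator_le m2 m0)),
      one_pow, mul_one, mul_one, mul_one] at h
  let T := (relSeries M 2).torsionOf (commute_of_mem_relSeries_two P.commutator_le h5) (n.choose 3)
  let f := QuotientGroup.mk' T
  have hf : Function.Surjective f := QuotientGroup.mk'_surjective T
  have : (M.map f).Normal := Subgroup.Normal.map inferInstance f hf
  have hQ : relSeries (M.map f) 3 = ⊥ := by
    rw [← map_relSeries hf, Subgroup.map_eq_bot_iff, QuotientGroup.ker_mk']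
    exact fun a ha => ⟨relSeries_antitone (by omega) ha, k3 a ha⟩
  let K := P.map f hf
  have fβ : ∀ x y, f (P.β x y) = K.β x y := fun x y => rfl
  have fι : ∀ x, f (P.ι x) = K.ι x := fun x => rfl
  have R' : ∀ x y, icomm (K.β x y) [K.ι x, K.ι x] = icomm (K.β x y) [K.ι y, K.ι y] := by
    intro x y
    have e1 := R x y
    have e2 := R y x
    rw [P.swap x y, inv_pow, inv_mul_eq_one] at e2
    rw [e2] at e1
    have mx : icomm (P.β x y) [P.ι x, P.ι x] ∈ relSeries M 2 :=
      icomm_mem_relSeries (k := 0) (P.β_mem x y) [P.ι x, P.ι x]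
    have my : icomm (P.β x y)⁻¹ [P.ι y, P.ι y] ∈ relSeries M 2 :=
      icomm_mem_relSeries (k := 0) (M := M) (inv_mem (P.β_mem x y)) [P.ι y, P.ι y]
    have hT : icomm (P.β x y)⁻¹ [P.ι y, P.ι y] * icomm (P.β x y) [P.ι x, P.ι x] ∈ T :=
      ⟨mul_mem my mx, by
        rw [(commute_of_mem_relSeries_two P.commutator_le h5 _ my _ mx).mul_pow, e1]⟩
    have hT' := (QuotientGroup.eq_one_iff _).2 hT
    change f _ = 1 at hT'
    rw [map_mul, map_icomm, map_icomm, map_inv] at hT'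
    simp only [List.map_cons, List.map_nil, fβ, fι] at hT'
    rwa [icomm_inv (M := M.map f) hQ (k := 0) (K.β_mem x y) _ le_rfl, inv_mul_eq_one, eq_comm] at hT'
  have R'' : ∀ k : ℕ, icomm (K.β x y) [K.ι x * K.ι y ^ k, K.ι x * K.ι y ^ k] =
      icomm (K.β x y) [K.ι y, K.ι y] := by
    intro k
    have hm : rcomm (K.β x y) (K.ι (y ^ k)) ∈ relSeries (M.map f) 1 :=
      rcomm_mem_relSeries (M := M.map f) (k := 0) (K.β_mem x y) _
    have drop : ∀ z, icomm (K.β (x * y ^ k) y) [z, z] = icomm (K.β x y) [z, z] :=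
      fun z => by
        rw [K.mul_pow_left, icomm_mul (M := M.map f) hQ (k := 0) (K.β_mem x y) (relSeries_succ_le 0 hm) _ le_rfl,
          icomm_eq_one (M := M.map f) hQ hm _ le_rfl, mul_one]
    have h := R' (x * y ^ k) y
    rwa [drop, drop, map_mul, map_pow] at h
  let c := K.β x y
  have hc : c ∈ relSeries (M.map f) 0 := K.β_mem x y
  let _ : CommGroup (Subgroup.center (S ⧸ T)) :=
    { mul_comm := fun a b => Subtype.ext (Subgroup.mem_center_iff.1 b.2 a) }
  let F : (S ⧸ T) → (S ⧸ T) → Additive (Subgroup.center (S ⧸ T)) := fun a₁ a₂ => Additive.ofMul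
    ⟨icomm c [a₁, a₂],
      mem_center_of_mem_relSeries hQ (k := 2) le_rfl (icomm_mem_relSeries hc [a₁, a₂])⟩
  have hF := second_difference (F := F)
    (fun a b a₂ => congrArg Additive.ofMul (Subtype.ext (icomm_mul_slot hQ hc [] a b [a₂] le_rfl)))
    (fun a₁ a b => congrArg Additive.ofMul (Subtype.ext (icomm_mul_slot hQ hc [a₁] a b [] le_rfl)))
    (K.ι x) (K.ι y)
  have hk : ∀ k : ℕ, F (K.ι x * K.ι y ^ k) (K.ι x * K.ι y ^ k) = F (K.ι y) (K.ι y) := fun k =>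
    congrArg Additive.ofMul (Subtype.ext (R'' k))
  have hk0 := hk 0
  have hk1 := hk 1
  rw [pow_zero, mul_one] at hk0
  rw [pow_one] at hk1
  have h0 : 2 • F (K.ι y) (K.ι y) = 0 := by
    rw [← hF, hk0, hk1, hk]
    module
  have h2' : icomm c [K.ι y, K.ι y] ^ 2 = 1 :=
    congrArg (fun z : Additive (Subgroup.center (S ⧸ T)) =>
      ((Additive.toMul z : Subgroup.center (S ⧸ T)) : S ⧸ T)) h0
  have mx : icomm (P.β x y) [P.ι x, P.ι x] ∈ relSeries M 2 :=
    icomm_mem_relSeries (k := 0) (P.β_mem x y) [P.ι x, P.ι x]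
  have hfx : f (icomm (P.β x y) [P.ι x, P.ι x]) = icomm c [K.ι y, K.ι y] := by
    rw [map_icomm, ← R']
    rfl
  have hI : f (icomm (P.β x y) [P.ι x, P.ι x]) = 1 :=
    eq_one_of_pow_of_coprime (Nat.coprime_two_left.2 hn) (hfx ▸ h2') (by
      rw [← map_pow, k1 _ (relSeries_antitone (by omega) mx), map_one])
  have hI' : icomm (P.β x y) [P.ι x, P.ι x] ^ n.choose 3 = 1 :=
    ((QuotientGroup.eq_one_iff _).1 hI).2
  have h := R x y
  rwa [hI', mul_one] at h

end ExteriorPairing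

/-! ### The crossed module `G ∧ G → G` and the concrete pairing. -/

section ExteriorSquareGroup

variable {G : Type*} [Group G]

namespace ExteriorSquare

/-- The symbol `g ∧ h`. -/
def wedge (g h : G) : ExteriorSquare G := PresentedGroup.of (g, h)

theorem wedge_mul_left (g g' h : G) :
    wedge (g * g') h = wedge (g'⁻¹ * g * g') (g'⁻¹ * h * g') * wedge g' h := by
  have := PresentedGroup.one_of_mem (rels := {r | ExteriorSquareRel G r})
    (ExteriorSquareRel.mul_left g g' h)
  rw [map_mul, map_inv, mul_inv_eq_one, map_mul] at this
  exact this

theorem wedge_mul_right (g h h' : G) :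
    wedge g (h * h') = wedge g h' * wedge (h'⁻¹ * g * h') (h'⁻¹ * h * h') := by
  have := PresentedGroup.one_of_mem (rels := {r | ExteriorSquareRel G r})
    (ExteriorSquareRel.mul_right g h h')
  rw [map_mul, map_inv, mul_inv_eq_one, map_mul] at this
  exact this

theorem wedge_self (g : G) : wedge g g = 1 :=
  PresentedGroup.one_of_mem (rels := {r | ExteriorSquareRel G r}) (ExteriorSquareRel.self g)

theorem closure_range_wedge :
    Subgroup.closure (Set.range fun st : G × G => wedge st.1 st.2) = ⊤ :=
  PresentedGroup.closure_range_of _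

/-- The homomorphism out of `G ∧ G` determined by the images of the symbols. -/
def lift {H : Type*} [Group H] (f : G → G → H)
    (hl : ∀ g g' h, f (g * g') h = f (g'⁻¹ * g * g') (g'⁻¹ * h * g') * f g' h)
    (hr : ∀ g h h', f g (h * h') = f g h' * f (h'⁻¹ * g * h') (h'⁻¹ * h * h'))
    (hs : ∀ g, f g g = 1) : ExteriorSquare G →* H :=
  PresentedGroup.toGroup (f := fun st : G × G => f st.1 st.2) (by
    rintro _ (⟨g, g', h⟩ | ⟨g, h, h'⟩ | ⟨g⟩)
    · simp [hl g g' h]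
    · simp [hr g h h']
    · simp [hs])

@[simp] theorem lift_wedge {H : Type*} [Group H] {f : G → G → H} (hl hr hs) (g h : G) :
    lift f hl hr hs (wedge g h) = f g h :=
  PresentedGroup.toGroup.of _

theorem hom_ext {H : Type*} [Group H] {f f' : ExteriorSquare G →* H}
    (h : ∀ s t, f (wedge s t) = f' (wedge s t)) : f = f' :=
  PresentedGroup.ext fun st => h st.1 st.2

/-- The homomorphism `G ∧ G → G`, `g ∧ h ↦ [g, h]`. -/
def toGroup : ExteriorSquare G →* G :=
  lift rcomm (fun g g' h => by simp only [rcomm]; group) (fun g h h' => by simp only [rcomm]; group)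
    (fun g => by simp only [rcomm]; group)

@[simp] theorem toGroup_wedge (g h : G) : toGroup (wedge g h) = rcomm g h := lift_wedge _ _ _ g h

/-- The endomorphism of `G ∧ G` induced by conjugation with `x`. -/
def conjHom (x : G) : ExteriorSquare G →* ExteriorSquare G :=
  lift (fun s t => wedge (x * s * x⁻¹) (x * t * x⁻¹))
    (fun g g' h => by
      rw [show x * (g * g') * x⁻¹ = (x * g * x⁻¹) * (x * g' * x⁻¹) by group, wedge_mul_left]
      congr 2 <;> group)
    (fun g h h' => by
      rw [show x * (h * h') * x⁻¹ = (x * h * x⁻¹) * (x * h' * x⁻¹) by group, wedge_mul_right]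
      congr 2 <;> group)
    (fun g => wedge_self _)

@[simp] theorem conjHom_wedge (x s t : G) :
    conjHom x (wedge s t) = wedge (x * s * x⁻¹) (x * t * x⁻¹) := lift_wedge _ _ _ s t

theorem conjHom_comp (x y : G) : (conjHom x).comp (conjHom y) = conjHom (x * y) :=
  hom_ext fun s t => by simp [mul_assoc]

theorem conjHom_one : conjHom (1 : G) = MonoidHom.id _ := hom_ext fun s t => by simp

/-- The action of `G` on `G ∧ G` by (left) conjugation. -/
def act : G →* MulAut (ExteriorSquare G) where
  toFun x := MonoidHom.toMulEquiv (conjHom x) (conjHom x⁻¹)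
    (by rw [conjHom_comp, inv_mul_cancel, conjHom_one])
    (by rw [conjHom_comp, mul_inv_cancel, conjHom_one])
  map_one' := MulEquiv.ext fun m => DFunLike.congr_fun conjHom_one m
  map_mul' x y := MulEquiv.ext fun m => (DFunLike.congr_fun (conjHom_comp x y) m).symm

theorem act_wedge (x s t : G) :
    act x (wedge s t) = wedge (x * s * x⁻¹) (x * t * x⁻¹) := conjHom_wedge x s t

theorem act_inv_wedge (x s t : G) :
    act x⁻¹ (wedge s t) = wedge (x⁻¹ * s * x) (x⁻¹ * t * x) := by
  rw [act_wedge, inv_inv]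

theorem act_act (x y : G) (m : ExteriorSquare G) : act x (act y m) = act (x * y) m := by
  rw [map_mul]; rfl

/-- Expanding gk ∧ hl from the left slot first and from the right slot first and cancelling gives
`key`, which is the claim on generators. -/
theorem act_rcomm (k l : G) (m : ExteriorSquare G) :
    act (rcomm k l)⁻¹ m = (wedge k l)⁻¹ * m * wedge k l := by
  have key : ∀ g h, act (l * k)⁻¹ (wedge g h) * wedge k l =
      wedge k l * act (k * l)⁻¹ (wedge g h) := by
    intro g h
    have e1 : wedge (g * k) (h * l) = wedge (k⁻¹ * g * k) (k⁻¹ * l * k) *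
        act (l * k)⁻¹ (wedge g h) * (wedge k l * wedge (l⁻¹ * k * l) (l⁻¹ * h * l)) := by
      rw [wedge_mul_left, wedge_mul_right k,
        show k⁻¹ * (h * l) * k = (k⁻¹ * h * k) * (k⁻¹ * l * k) by group, wedge_mul_right,
        act_inv_wedge]
      congr 3 <;> group
    have e2 : wedge (g * k) (h * l) = wedge (k⁻¹ * g * k) (k⁻¹ * l * k) * wedge k l *
        (act (k * l)⁻¹ (wedge g h) * wedge (l⁻¹ * k * l) (l⁻¹ * h * l)) := by
      rw [wedge_mul_right, wedge_mul_left,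
        show l⁻¹ * (g * k) * l = (l⁻¹ * g * l) * (l⁻¹ * k * l) by group, wedge_mul_left _ _ (l⁻¹ * h * l),
        act_inv_wedge]
      congr 3 <;> group
    rw [e1, ← mul_assoc, ← mul_assoc, mul_left_inj] at e2
    apply mul_left_cancel (a := wedge (k⁻¹ * g * k) (k⁻¹ * l * k))
    rw [← mul_assoc, ← mul_assoc]
    exact e2
  have h1 : (MulAut.conj (wedge k l)⁻¹).toMonoidHom.comp (act (l * k)⁻¹).toMonoidHom =
      (act (k * l)⁻¹).toMonoidHom := hom_ext fun g h => by
    have := key g h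
    simp only [MonoidHom.comp_apply, MulEquiv.coe_toMonoidHom, MulAut.conj_apply, inv_inv]
    rw [mul_assoc, this, inv_mul_cancel_left]
  have h2 := DFunLike.congr_fun h1 (act (l * k) m)
  simp only [MonoidHom.comp_apply, MulEquiv.coe_toMonoidHom, MulAut.conj_apply, inv_inv, act_act,
    inv_mul_cancel, map_one, MulAut.one_apply] at h2
  rw [h2]
  congr 2
  simp only [rcomm]; group

/-- The Peiffer identity. -/
theorem act_toGroup (m m' : ExteriorSquare G) : act (toGroup m') m = m' * m * m'⁻¹ := by
  have h : act.comp toGroup = (MulAut.conj : ExteriorSquare G →* _) := hom_ext fun k l => by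
    rw [← inv_inj, MonoidHom.comp_apply, toGroup_wedge, ← map_inv, ← map_inv]
    ext m
    rw [act_rcomm, MulAut.conj_apply, inv_inv]
  exact DFunLike.congr_fun (DFunLike.congr_fun h m') m

theorem wedge_one_left (g : G) : wedge 1 g = 1 := by
  simpa using wedge_mul_left 1 1 g

theorem wedge_mul_left' (g g' h : G) :
    wedge (g * g') h = act g'⁻¹ (wedge g h) * wedge g' h := by
  rw [wedge_mul_left, act_inv_wedge]

theorem act_wedge_inv_left (g k : G) : act g⁻¹ (wedge g⁻¹ k) = (wedge g k)⁻¹ := by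
  rw [eq_inv_iff_mul_eq_one, ← wedge_mul_left', inv_mul_cancel, wedge_one_left]

theorem wedge_rcomm_left (g h k : G) :
    wedge (rcomm g h) k = (wedge g h)⁻¹ * act k⁻¹ (wedge g h) := by
  have h1 : act (h⁻¹ * g * h)⁻¹ (wedge g⁻¹ k) =
      (wedge g h)⁻¹ * (wedge g k)⁻¹ * wedge g h := by
    rw [← act_rcomm, ← act_wedge_inv_left, act_act]
    congr 2
    simp only [rcomm]; group
  -- Two expansions of g ∧ hk, one through hk = (hkh⁻¹)h.
  have h2 : wedge g h * wedge (h⁻¹ * g * h) k = wedge g k * act k⁻¹ (wedge g h) := by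
    have e1 := wedge_mul_right g (h * k * h⁻¹) h
    rw [show h⁻¹ * (h * k * h⁻¹) * h = k by group, inv_mul_cancel_right] at e1
    rw [← e1, wedge_mul_right, act_inv_wedge]
  rw [show rcomm g h = g⁻¹ * (h⁻¹ * g * h) by simp only [rcomm]; group, wedge_mul_left', h1,
    mul_assoc, h2]
  group

theorem wedge_toGroup_left (m : ExteriorSquare G) (g : G) :
    wedge (toGroup m) g = m⁻¹ * act g⁻¹ m := by
  have hm : m ∈ Subgroup.closure (Set.range fun st : G × G => wedge st.1 st.2) := by
    rw [closure_range_wedge]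
    exact Subgroup.mem_top m
  induction hm using Subgroup.closure_induction with
  | mem _ h =>
    obtain ⟨⟨s, t⟩, rfl⟩ := h
    rw [toGroup_wedge, wedge_rcomm_left]
  | one => simp [wedge_one_left]
  | mul a b _ _ ha hb =>
    rw [map_mul, wedge_mul_left', ← map_inv, act_toGroup, ha, hb, map_mul]
    group
  | inv a _ ha =>
    have h := act_wedge_inv_left (toGroup a) g
    rw [ha, ← map_inv, act_toGroup] at h
    rw [map_inv] at h
    have h' : wedge (toGroup a)⁻¹ g = a * (a⁻¹ * act g⁻¹ a)⁻¹ * a⁻¹ := by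
      rw [← h]
      group
    rw [map_inv, map_inv, h']
    group

theorem wedge_swap (g h : G) : wedge h g = (wedge g h)⁻¹ := by
  rw [eq_comm, inv_eq_iff_mul_eq_one]
  have e := wedge_self (h * g * h⁻¹ * h)
  rw [wedge_mul_left, wedge_mul_right h, wedge_self h,
    show h⁻¹ * (h * g * h⁻¹) * h = g by group, show h⁻¹ * (h * g * h⁻¹ * h) * h = g * h by group,
    wedge_mul_right g g h, wedge_self, mul_one, one_mul, show h⁻¹ * h * h = h by group] at e
  exact e

/-- The semidirect product of `G ∧ G` with `G`. -/
abbrev Extension (G : Type*) [Group G] := ExteriorSquare G ⋊[act (G := G)] G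

theorem conj_inl (x : G) (m : ExteriorSquare G) :
    (SemidirectProduct.inr x : Extension G)⁻¹ * SemidirectProduct.inl m * SemidirectProduct.inr x =
      SemidirectProduct.inl (act x⁻¹ m) := by
  rw [SemidirectProduct.inl_aut, map_inv, inv_inv]

/-- The exterior pairing of `G` with values in the extension of `G` by `G ∧ G`. -/
def pairing (G : Type*) [Group G] :
    ExteriorPairing G (SemidirectProduct.inl : ExteriorSquare G →* Extension G).range where
  ι := SemidirectProduct.inr
  β s t := SemidirectProduct.inl (wedge s t)
  closure_range := by
    rw [MonoidHom.range_eq_map, ← closure_range_wedge, MonoidHom.map_closure, ← Set.range_comp]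
    rfl
  sup_range := by
    refine eq_top_iff.2 fun s _ => ?_
    rw [← SemidirectProduct.inl_left_mul_inr_right s]
    exact Subgroup.mul_mem_sup ⟨_, rfl⟩ ⟨_, rfl⟩
  mul_left s s' t := by rw [wedge_mul_left', map_mul, conj_inl]
  conj s t x := by rw [conj_inl, act_inv_wedge]
  self s := by rw [wedge_self, map_one]
  swap s t := by rw [wedge_swap, map_inv]
  rcomm_left s x t := by
    rw [wedge_rcomm_left, map_mul, map_inv, ← conj_inl]
    simp only [rcomm]; group
  rcomm_β := by
    rintro _ ⟨m, rfl⟩ s t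
    rw [← map_rcomm, ← map_rcomm]
    have h : rcomm (SemidirectProduct.inl m : Extension G) (SemidirectProduct.inr (rcomm s t)) =
        SemidirectProduct.inl (m⁻¹ * act (rcomm s t)⁻¹ m) := by
      rw [map_mul, ← conj_inl, map_inv]
      simp only [rcomm]; group
    rw [h, act_rcomm]
    congr 1
    simp only [rcomm]; group

/-- The homomorphism `Extension G → G`, `(m, g) ↦ [m] g`. -/
def extensionToGroup : Extension G →* G :=
  SemidirectProduct.lift toGroup (MonoidHom.id G) fun g => hom_ext fun s t => by
    simp [act_wedge, rcomm, mul_assoc]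

/-- If m maps to 1 in G, then 1 = 1 ∧ g = m⁻¹ m^g shows that G fixes m, and the Peiffer identity
makes m commute with `G ∧ G`. -/
theorem mem_center_of_extensionToGroup_eq_one {a : Extension G}
    (ha : a ∈ (SemidirectProduct.inl : ExteriorSquare G →* Extension G).range)
    (h : extensionToGroup a = 1) : a ∈ Subgroup.center (Extension G) := by
  obtain ⟨m, rfl⟩ := ha
  have hm : toGroup m = 1 := by simpa [extensionToGroup] using h
  have hg : ∀ g, act g m = m := fun g => by
    have := wedge_toGroup_left m g⁻¹
    rwa [hm, wedge_one_left, inv_inv, eq_comm, inv_mul_eq_one, eq_comm] at this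
  have hm' : ∀ m', m' * m = m * m' := fun m' => by
    have := act_toGroup m' m
    rw [hm, map_one, MulAut.one_apply, eq_mul_inv_iff_mul_eq] at this
    exact this
  refine Subgroup.mem_center_iff.2 fun s => SemidirectProduct.ext ?_ ?_
  · simp [hg, hm']
  · simp

/-- M_k maps into γ_{k+2}(G), which is `lowerCentralSeries (k + 1)` since that series is indexed
from 0. So M_4 maps to γ_6(G) = 1 and is central. -/
theorem relSeries_five_eq_bot (hG : (⊤ : Subgroup G).lowerCentralSeries 5 = ⊥) :
    relSeries (SemidirectProduct.inl : ExteriorSquare G →* Extension G).range 5 = ⊥ := by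
  set M := (SemidirectProduct.inl : ExteriorSquare G →* Extension G).range with hM
  have hf : Function.Surjective (extensionToGroup (G := G)) := fun g =>
    ⟨SemidirectProduct.inr g, by simp [extensionToGroup]⟩
  have h0 : M.map extensionToGroup ≤ (⊤ : Subgroup G).lowerCentralSeries 1 := by
    rw [Subgroup.map_le_iff_le_comap]
    refine (pairing G).closure_range.symm.trans_le ((Subgroup.closure_le _).2 ?_)
    rintro _ ⟨⟨s, t⟩, rfl⟩
    change extensionToGroup (SemidirectProduct.inl (wedge s t)) ∈ (⊤ : Subgroup G).lowerCentralSeries 1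
    rw [extensionToGroup, SemidirectProduct.lift_inl, toGroup_wedge, rcomm_eq_commutatorElement]
    exact Subgroup.commutator_mem_commutator (Subgroup.mem_top _) (Subgroup.mem_top _)
  have hk : ∀ k, relSeries (M.map extensionToGroup) k ≤
      (⊤ : Subgroup G).lowerCentralSeries (k + 1) := by
    intro k
    induction k with
    | zero => exact h0
    | succ k ih => exact Subgroup.commutator_mono ih le_rfl
  have : M.Normal := by
    rw [hM, SemidirectProduct.range_inl_eq_ker_rightHom]
    infer_instance
  have h4 : relSeries M 4 ≤ Subgroup.center (Extension G) := fun a ha => by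
    refine mem_center_of_extensionToGroup_eq_one (relSeries_antitone (M := M) (Nat.zero_le 4) ha) ?_
    have h := hk 4
    rw [hG, ← map_relSeries hf] at h
    exact Subgroup.mem_bot.1 (h ⟨a, ha, rfl⟩)
  exact Subgroup.commutator_top_right_eq_bot_iff_le_center.2 h4

/-- Both homomorphisms from the extension to G, the projection and `extensionToGroup`, kill s^n. -/
theorem pow_mem_center {n : ℕ} (hn : ∀ g : G, g ^ n = 1) (s : Extension G) :
    s ^ n ∈ Subgroup.center (Extension G) := by
  refine mem_center_of_extensionToGroup_eq_one ?_ (by rw [map_pow, hn])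
  rw [SemidirectProduct.range_inl_eq_ker_rightHom, MonoidHom.mem_ker, map_pow, hn]

theorem pow_eq_one {n : ℕ} (hG : (⊤ : Subgroup G).lowerCentralSeries 5 = ⊥)
    (hn : ∀ g : G, g ^ n = 1) (hodd : Odd n) (h35 : Nat.Coprime 3 n ∨ Nat.Coprime 5 n)
    (t : ExteriorSquare G) : t ^ n = 1 := by
  have hM : (SemidirectProduct.inl : ExteriorSquare G →* Extension G).range.Normal := by
    rw [SemidirectProduct.range_inl_eq_ker_rightHom]
    infer_instance
  -- From (k + 1) C(n, k + 1) = n C(n − 1, k).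
  have hdvd : ∀ k, Nat.Coprime (k + 1) n → n ∣ n.choose (k + 1) := by
    intro k hk
    rcases n with _ | n
    · simp
    · exact hk.symm.dvd_of_dvd_mul_right ⟨_, (Nat.add_one_mul_choose_eq n k).symm⟩
  have c2 : Nat.Coprime 2 n := Nat.coprime_two_left.2 hodd
  have c4 : Nat.Coprime 4 n := Nat.Coprime.pow_left 2 c2
  have h5 := relSeries_five_eq_bot hG
  have key : ∀ a ∈ (SemidirectProduct.inl : ExteriorSquare G →* Extension G).range, a ^ n = 1 := by
    rcases h35 with h | h
    · exact (pairing G).pow_eq_one_of_dvd_choose_three h5 (pow_mem_center hn) hn (hdvd 1 c2)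
        (hdvd 3 c4) (Nat.Coprime.mul_left h (Nat.Coprime.pow_left 3 c2)) (hdvd 2 h)
    · exact (pairing G).pow_eq_one_of_dvd_choose_five h5 (pow_mem_center hn) hn hodd (hdvd 1 c2)
        (hdvd 3 c4) (hdvd 4 h)
  have h := key _ ⟨t, rfl⟩
  rw [← map_pow] at h
  exact SemidirectProduct.inl_injective (h.trans (map_one _).symm)

end ExteriorSquare

end ExteriorSquareGroup

theorem corollary3p8 {p : ℕ} (hp : p.Prime) (hodd : Odd p)
    {G : Type*} [Group G] [Group.IsNilpotent G] (hG : IsPGroup p G)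
    (hclass : Group.nilpotencyClass G ≤ 5) :
    Monoid.exponent (ExteriorSquare G) ∣ Monoid.exponent G := by
  rcases eq_or_ne (Monoid.exponent G) 0 with h0 | h0
  · rw [h0]
    exact dvd_zero _
  have hprime : ∀ r : ℕ, r.Prime → r ∣ Monoid.exponent G → r = p := by
    intro r hr hrn
    obtain ⟨g, hg⟩ := hr.exists_orderOf_eq_pow_factorization_exponent G
    obtain ⟨k, hk⟩ := hG g
    have h1 : r ∣ orderOf g := by
      rw [hg]
      exact dvd_pow_self r (hr.factorization_pos_of_dvd h0 hrn).ne'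
    exact (Nat.prime_dvd_prime_iff_eq hr hp).1
      (hr.dvd_of_dvd_pow (h1.trans (orderOf_dvd_of_pow_eq_one hk)))
  have hcop : ∀ r : ℕ, r.Prime → r ≠ p → Nat.Coprime r (Monoid.exponent G) := fun r hr hrp =>
    (Nat.Prime.coprime_iff_not_dvd hr).2 fun h => hrp (hprime r hr h)
  refine Monoid.exponent_dvd_of_forall_pow_eq_one (ExteriorSquare.pow_eq_one
    (Subgroup.lowerCentralSeries_eq_bot_iff_nilpotencyClass_le.2 hclass)
    Monoid.pow_exponent_eq_one ?_ ?_)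
  · exact Nat.coprime_two_left.1 (hcop 2 Nat.prime_two (by rintro rfl; exact absurd hodd (by decide)))
  -- Every prime factor of the exponent is p, so 3 and 5 cannot both divide it.
  · rcases eq_or_ne p 3 with h | h
    · exact Or.inr (hcop 5 Nat.prime_five (by omega))
    · exact Or.inl (hcop 3 Nat.prime_three h.symm)
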